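/- Let $n\ge 2$, let $I=\{1,\dots,n+1\}$ index the Dynkin diagram of type $D_{n+1}$ (for $n=2$ this is $D_3=A_3$), with simple roots $\alpha_i=\varepsilon_i-\varepsilon_{i+1}$ $(i\le n)$, $\alpha_{n+1}=\varepsilon_n+\varepsilon_{n+1}$, simple reflections $s_i$, and positive roots $\Phi^+=\{\varepsilon_a\pm\varepsilon_b: 1\le a<b\le n+1\}$. Let $\vee$ be the diagram automorphism exchanging $n$ and $n+1$, let $\bar i$ be the $\vee$-orbit of $i$ and $|\bar i|$ its size, and let $\bar I$ be the set of orbits, identified with $\{1,\dots,n\}$ through smallest representatives. For a word $\mathbf c=i_1\cdots i_n$ let $\mathbf c^{k\vee}$ be the word obtained by applying $\vee$ to each letter $k$ times, and put $\mathbf i(\mathbf c)=\mathbf c^{0\vee}\mathbf c^{1\vee}\cdots\mathbf c^{n\vee}$. Let $i\mapsto i^*$ be the involution of $I$ with $w_0\alpha_i=-\alpha_{i^*}$, where $w_0$ is the longest element of the Weyl group. A commutation class $[\mathbf w]$ of words consists of the words obtained from $\mathbf w$ by exchanging neighbouring letters whose simple reflections commute. A class is called twisted adapted if it is obtained from $[\mathbf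 i(1\,2\cdots n)]$ by a finite sequence of moves $[j\,\mathbf u]\mapsto[\mathbf u\, j^*]$ and $[\mathbf u\, j]\mapsto[j^*\,\mathbf u]$. Let $[\mathbf i_0]$ be a twisted adapted class. A coordinate datum for it consists of a word $\mathbf c=i_1\cdots i_n$ containing exactly one index from each $\vee$-orbit, with $\mathbf i(\mathbf c)\in[\mathbf i_0]$; an orientation $Q$ of the Dynkin diagram of type $A_n$ on $\bar I=\{1,\dots,n\}$ to which $\bar i_1\cdots\bar i_n$ is adapted (each $\bar i_k$ is a sink of the quiver obtained from $Q$ by successively reversing all arrows at $\bar i_1,\dots,\bar i_{k-1}$); and a function $\xi:\bar I\to\mathbb Z$ with $\xi(\bar i)=\xi(\bar j)+1$ whenever $Q$ has an arrow from $\bar j$ to $\bar i$. Given such a datum, coordinates $(i,p)\in I\times\mathbb Z$ are assigned to positive roots as follows: $s_{i_1}\cdots s_{i_{k-1}}(\alpha_{i_k})$ has coordinate $(i_k,\xi(\bar i_k))$; $s_{i_1}\cdots s_{i_n}s_{i_1^\vee}\cdots s_{i_{k-1}^\vee}(\alpha_{i_k^\vee})$ has coordinate $(i_k^\vee,\xi(\bar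 i_k)-2)$; and if $\gamma$ and $\psi(\gamma)$ are positive roots, where $\psi=s_{i_1}\cdots s_{i_n}s_{i_1^\vee}\cdots s_{i_n^\vee}$, and $\gamma$ has coordinate $(i,p)$, then $\psi(\gamma)$ has coordinate $(i,p-4)$. The folded AR-quiver has vertex set $\Phi^+$; a root with coordinate $(i,p)$ has folded coordinate $(\bar i,p)$, and there is an arrow from a root with coordinate $(i,p)$ to a root with coordinate $(j,q)$ if and only if $i$ and $j$ are adjacent in the Dynkin diagram of type $D_{n+1}$ and $q=p+1$. **Theorem 6.4 (twisted additive property of $D_{n+1}$).** Every twisted adapted class $[\mathbf i_0]$ has a coordinate datum. For every coordinate datum of $[\mathbf i_0]$, if $\alpha,\beta\in\Phi^+$ have folded coordinates $(\bar i,p-2^{|\bar i|})$ and $(\bar i,p)$ in the resulting folded AR-quiver, then $$\alpha+\beta=\sum_{\gamma\in\mathcal J}\gamma,$$ where $\mathcal J\subset\Phi^+$ is the set of roots $\gamma$ that lie on a path from $\alpha$ to $\beta$ and have folded coordinate $(\bar j,\,p-2^{|\bar i|-1})$ for some $\bar j\in\bar I$. -/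

import Mathlib

namespace TwistedD

/-! The root system of type `D_{n+1}` in `ℤ^{n+1}`. All indices are shifted by one: the index
`i ∈ {1, …, n+1}` of the Dynkin diagram and the vector `ε_i` correspond to `i - 1 : Fin (n+1)`, and
the orbits `1, …, n` of the automorphism `∨` correspond to `0, …, n-1 : Fin n`. -/

/-- The vector `ε_a`. -/
def eps {n : ℕ} (a : Fin (n + 1)) : Fin (n + 1) → ℤ := Pi.single a 1

/-- The simple roots `ε_i - ε_{i+1}` for `i ≤ n`, and `ε_n + ε_{n+1}` for `i = n+1`
(indices counted from `1`). -/
def simpleRoot {n : ℕ} (i : Fin (n + 1)) : Fin (n + 1) → ℤ :=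
  if h : i.val < n then eps i - eps ⟨i.val + 1, by omega⟩
  else eps ⟨n - 1, by omega⟩ + eps (Fin.last n)

/-- The positive roots `ε_a - ε_b` and `ε_a + ε_b` with `a < b`. -/
def posRoots (n : ℕ) : Finset (Fin (n + 1) → ℤ) :=
  (Finset.univ.filter fun x : Fin (n + 1) × Fin (n + 1) => x.1 < x.2).image
      (fun x => eps x.1 - eps x.2) ∪
    (Finset.univ.filter fun x : Fin (n + 1) × Fin (n + 1) => x.1 < x.2).image
      (fun x => eps x.1 + eps x.2)

/-- The simple reflection `s_i` (every root has square length `2`). -/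
def refl {n : ℕ} (i : Fin (n + 1)) (v : Fin (n + 1) → ℤ) : Fin (n + 1) → ℤ :=
  v - (v ⬝ᵥ simpleRoot i) • simpleRoot i

/-- The action of `s_{i_1} s_{i_2} ⋯ s_{i_l}` for the word `i_1 i_2 ⋯ i_l`. -/
def act {n : ℕ} (w : List (Fin (n + 1))) (v : Fin (n + 1) → ℤ) : Fin (n + 1) → ℤ :=
  w.foldr refl v

/-- Adjacency in the Dynkin diagram of type `D_{n+1}`. -/
def DynkinAdj {n : ℕ} (i j : Fin (n + 1)) : Prop := simpleRoot i ⬝ᵥ simpleRoot j = -1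

/-- The diagram automorphism `∨` that exchanges the last two indices `n` and `n+1`
(counted from `1`) and fixes the others. -/
def vee {n : ℕ} (i : Fin (n + 1)) : Fin (n + 1) :=
  if i.val = n then ⟨n - 1, by omega⟩ else if i.val + 1 = n then Fin.last n else i

/-- The involution `i ↦ i^*` with `w_0 (α_i) = -α_{i^*}`: the longest element `w_0` is `-1` if `n+1`
is even, and changes the sign of every `ε_a` but the last one if `n+1` is odd. -/
def star {n : ℕ} (i : Fin (n + 1)) : Fin (n + 1) := if Even (n + 1) then i else vee i

/-- The orbit of an index under `∨`, as an element of `{1, …, n}` (counted from `1`): both `n` and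
`n+1` lie in the orbit `n`. -/
def bar {n : ℕ} [NeZero n] (i : Fin (n + 1)) : Fin n :=
  ⟨min i.val (n - 1), by have := NeZero.pos n; omega⟩

theorem bar_eq_bar_iff {n : ℕ} [NeZero n] (i j : Fin (n + 1)) :
    bar i = bar j ↔ i = j ∨ i = vee j := by
  have hn := NeZero.pos n
  simp only [bar, vee, Fin.mk.injEq]
  split_ifs <;> simp only [Fin.ext_iff, Fin.val_last] <;> omega

/-- The number of indices in an orbit of `∨`. -/
def orbitSize {n : ℕ} [NeZero n] (b : Fin n) : ℕ :=
  (Finset.univ.filter fun i : Fin (n + 1) => bar i = b).card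

/-! Commutation classes, reflection functors and the twisted adapted cluster point. -/

/-- One commutation move: exchange two neighbouring letters whose simple reflections commute. -/
inductive CommMove {n : ℕ} : List (Fin (n + 1)) → List (Fin (n + 1)) → Prop
  | swap (u v : List (Fin (n + 1))) (i j : Fin (n + 1)) (h : ¬ DynkinAdj i j) :
      CommMove (u ++ i :: j :: v) (u ++ j :: i :: v)

/-- Commutation equivalence of words; the commutation class of `w` is `{w' | CommEquiv w w'}`. -/
def CommEquiv {n : ℕ} : List (Fin (n + 1)) → List (Fin (n + 1)) → Prop :=
  Relation.EqvGen CommMove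

/-- `[w']` arises from `[w]` by a right reflection functor at a sink `i` of `[w]`, or by a left
reflection functor at a source `i` of `[w]`. -/
inductive ReflectionStep {n : ℕ} : List (Fin (n + 1)) → List (Fin (n + 1)) → Prop
  | sink (w w' u : List (Fin (n + 1))) (i : Fin (n + 1))
      (hw : CommEquiv w (i :: u)) (hw' : CommEquiv w' (u ++ [star i])) : ReflectionStep w w'
  | source (w w' u : List (Fin (n + 1))) (i : Fin (n + 1))
      (hw : CommEquiv w (u ++ [i])) (hw' : CommEquiv w' (star i :: u)) : ReflectionStep w w'

/-- The word `∏_{k=0}^{n} (i_1 i_2 ⋯ i_n)^{k∨}`. -/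
def twistedWord {n : ℕ} (c : List (Fin (n + 1))) : List (Fin (n + 1)) :=
  (List.range (n + 1)).flatMap fun k => c.map (vee^[k])

/-- `[w]` is a twisted adapted class: it lies in the `r`-cluster point of
`∏_{k=0}^{n} (1 2 ⋯ n)^{k∨}`. The generation by `CommEquiv` next to the reflection functors
expresses that the notion depends only on the class of `w`. -/
def IsTwistedAdapted {n : ℕ} (w : List (Fin (n + 1))) : Prop :=
  Relation.ReflTransGen (fun u v => CommEquiv u v ∨ ReflectionStep u v)
    (twistedWord ((List.finRange n).map Fin.castSucc)) w

/-- `(s_{i_1} ⋯ s_{i_n})∨` is a twisted Coxeter element: the letters of `i_1 ⋯ i_n` are one index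
from each orbit of `∨`, in any order. -/
def IsTwistedCoxeterWord {n : ℕ} [NeZero n] (c : List (Fin (n + 1))) : Prop :=
  (c.map bar).Perm (List.finRange n)

/-! Dynkin quivers of type `A_n`; `Q i j` means that there is an arrow from `i` to `j`. -/

/-- `Q` is an orientation of the Dynkin diagram of type `A_n`. -/
def IsDynkinQuiver {n : ℕ} (Q : Fin n → Fin n → Prop) : Prop :=
  (∀ i j, Q i j → i.val + 1 = j.val ∨ j.val + 1 = i.val) ∧
    ∀ i j : Fin n, i.val + 1 = j.val → Xor (Q i j) (Q j i)

/-- The quiver obtained by reversing every arrow at the vertex `i`. -/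
def reverseAt {n : ℕ} (Q : Fin n → Fin n → Prop) (i : Fin n) : Fin n → Fin n → Prop :=
  fun a b => if a = i ∨ b = i then Q b a else Q a b

/-- The word `i_1 i_2 ⋯` is adapted to `Q`: each `i_k` is a sink of `i_{k-1} ⋯ i_1 Q`. -/
def IsAdaptedTo {n : ℕ} : (Fin n → Fin n → Prop) → List (Fin n) → Prop
  | _, [] => True
  | Q, i :: w => (∀ j, ¬ Q i j) ∧ IsAdaptedTo (reverseAt Q i) w

/-- Height functions of `Q`: `ξ(i) = ξ(j) + 1` if there is an arrow from `j` to `i`. -/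
def IsHeightFunction {n : ℕ} (Q : Fin n → Fin n → Prop) (ξ : Fin n → ℤ) : Prop :=
  ∀ i j, Q j i → ξ i = ξ j + 1

/-- The data from which the coordinates on the twisted AR-quiver of the class `[w]` are built: a
twisted Coxeter element `(s_{i_1} ⋯ s_{i_n})∨`, given by the word `c = i_1 ⋯ i_n`, with
`∏_{k=0}^{n} (i_1 ⋯ i_n)^{k∨}` in `[w]`; the Dynkin quiver `Q` of type `A_n` whose Coxeter element
is obtained from `i_1 ⋯ i_n` by replacing the letter `n+1`, if it occurs, by `n`; and a height
function `ξ` of `Q`. -/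
structure IsCoordinateDatum {n : ℕ} [NeZero n] (w c : List (Fin (n + 1)))
    (Q : Fin n → Fin n → Prop) (ξ : Fin n → ℤ) : Prop where
  coxeter : IsTwistedCoxeterWord c
  mem_class : CommEquiv w (twistedWord c)
  quiver : IsDynkinQuiver Q
  adapted : IsAdaptedTo Q (c.map bar)
  height : IsHeightFunction Q ξ

/-! Coordinates, twisted and folded AR-quivers. -/

/-- `HasCoord c ξ β i p` : the root `β` has the coordinate `(i, p)` in the twisted AR-quiver. With
`c = i_1 ⋯ i_n`, the root `s_{i_1} ⋯ s_{i_{k-1}}(α_{i_k})` has the coordinate `(i_k, ξ(i_k))`, the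
root `s_{i_1} ⋯ s_{i_n} s_{i_1^∨} ⋯ s_{i_{k-1}^∨}(α_{i_k^∨})` has the coordinate
`(i_k^∨, ξ(i_k) - 2)`, and the coordinates are extended by the rule that
`ψ = s_{i_1} ⋯ s_{i_n} s_{i_1^∨} ⋯ s_{i_n^∨}` shifts `(i, p)` to `(i, p - 4)` as long as it maps a
positive root to a positive root. -/
inductive HasCoord {n : ℕ} [NeZero n] (c : List (Fin (n + 1))) (ξ : Fin n → ℤ) :
    (Fin (n + 1) → ℤ) → Fin (n + 1) → ℤ → Prop
  | first (u v : List (Fin (n + 1))) (i : Fin (n + 1)) (hc : c = u ++ i :: v) :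
      HasCoord c ξ (act u (simpleRoot i)) i (ξ (bar i))
  | second (u v : List (Fin (n + 1))) (i : Fin (n + 1)) (hc : c = u ++ i :: v) :
      HasCoord c ξ (act (c ++ u.map vee) (simpleRoot (vee i))) (vee i) (ξ (bar i) - 2)
  | step (β : Fin (n + 1) → ℤ) (i : Fin (n + 1)) (p : ℤ) (hβ : β ∈ posRoots n)
      (hψβ : act (c ++ c.map vee) β ∈ posRoots n) (h : HasCoord c ξ β i p) :
      HasCoord c ξ (act (c ++ c.map vee) β) i (p - 4)

/-- `β` has the folded coordinate `(b, p)`. -/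
def HasFoldedCoord {n : ℕ} [NeZero n] (c : List (Fin (n + 1))) (ξ : Fin n → ℤ)
    (β : Fin (n + 1) → ℤ) (b : Fin n) (p : ℤ) : Prop :=
  ∃ i, bar i = b ∧ HasCoord c ξ β i p

/-- The arrows `(i, p) → (j, p + 1)`, for adjacent `i` and `j`, of the twisted AR-quiver, which are
also the arrows of the folded AR-quiver; the vertices are named by their labels in `Φ⁺`. -/
def Arrow {n : ℕ} [NeZero n] (c : List (Fin (n + 1))) (ξ : Fin n → ℤ)
    (γ δ : Fin (n + 1) → ℤ) : Prop :=
  γ ∈ posRoots n ∧ δ ∈ posRoots n ∧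
    ∃ i j p, HasCoord c ξ γ i p ∧ HasCoord c ξ δ j (p + 1) ∧ DynkinAdj i j

/-- `γ` lies on a path from `α` to `β` in the folded AR-quiver. -/
def OnPath {n : ℕ} [NeZero n] (c : List (Fin (n + 1))) (ξ : Fin n → ℤ)
    (α β γ : Fin (n + 1) → ℤ) : Prop :=
  Relation.ReflTransGen (Arrow c ξ) α γ ∧ Relation.ReflTransGen (Arrow c ξ) γ β

open Classical in
/-- The positive roots on paths from `α` to `β` whose folded coordinate has second entry `q`. -/
noncomputable def betweenAt {n : ℕ} [NeZero n] (c : List (Fin (n + 1))) (ξ : Fin n → ℤ)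
    (α β : Fin (n + 1) → ℤ) (q : ℤ) : Finset (Fin (n + 1) → ℤ) :=
  (posRoots n).filter fun γ => OnPath c ξ α β γ ∧ ∃ j, HasFoldedCoord c ξ γ j q

end TwistedD

namespace TwistedD

/-! Let φ = s_{i_1}⋯s_{i_n}∨, where ∨ acts on ℤ^{n+1} by changing the sign of the last coordinate,
so that ψ = φ². The roots φ^k(`root b`), 0 ≤ k ≤ n, where `root b` is the root of the first slice in
the orbit b, are exactly the vertices with folded coordinates (b, ξ b − 2k) (`hasCoord_iff`). The
theorem becomes an identity between φ-translates of the first slice.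

The first slice satisfies a mesh relation (`mesh_aux`): `root b` + φ(`root b`) is the sum over the
neighbours b' of `root b'` or φ(`root b'`), depending on the direction of the edge, with an extra
term 2φ(e), e = ±ε_{n+1}, for the last orbit. Away from the last orbit, applying φ^k gives the
claim.

For the last orbit α = φ²β, and an explicit model is used. Put e_k = φ^k(e). The last root of the
slice is e_0 + e_1, and the mesh relations propagate this to `root b` = e_s + e_{s+n-b}, with s
determined by ξ (`exists_eq_add_of_mesh`); the boundary condition at the far end of the diagram
gives e_{k+n+1} = −e_k. Then β = e_m + e_{m+1}, α = e_{m+2} + e_{m+3}, and the roots halfway between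
are e_{m+1} + e_{m+2} and e_m + e_{m+3}.

The model also makes the coordinates unique: e_0, …, e_n are the standard basis up to order and
signs, so a root has one such expression. With the fact that φ^{n+1} negates every slice, this
locates where positivity stops.

A coordinate datum exists because a reflection functor at a sink of 𝐢(𝐜) merely moves the first
letter i of a suitable representative of 𝐜 to its end as i^∨. -/

theorem dotProduct_simpleRoot {n : ℕ} (v : Fin (n + 1) → ℤ) (i : Fin (n + 1)) :
    v ⬝ᵥ simpleRoot i = if h : i.val < n then v i - v ⟨i.val + 1, by omega⟩
      else v ⟨n - 1, by omega⟩ + v (Fin.last n) := by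
  unfold simpleRoot
  split_ifs <;> simp [eps, dotProduct_sub, dotProduct_add]

theorem dynkinAdj_iff {n : ℕ} [NeZero n] (hn : 2 ≤ n) (i j : Fin (n + 1)) :
    DynkinAdj i j ↔ (bar i).val + 1 = (bar j).val ∨ (bar j).val + 1 = (bar i).val := by
  have hi := i.isLt
  have hj := j.isLt
  unfold DynkinAdj
  rw [dotProduct_simpleRoot]
  simp only [simpleRoot, eps, bar]
  split_ifs <;>
    simp only [Pi.sub_apply, Pi.add_apply, Pi.single_apply, Fin.ext_iff, Fin.val_last] <;>
    split_ifs <;> omega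

theorem dynkinAdj_comm {n : ℕ} (i j : Fin (n + 1)) : DynkinAdj i j ↔ DynkinAdj j i := by
  unfold DynkinAdj
  rw [dotProduct_comm]

theorem bar_vee {n : ℕ} [NeZero n] (i : Fin (n + 1)) : bar (vee i) = bar i :=
  (bar_eq_bar_iff _ _).2 (Or.inr rfl)

theorem vee_vee {n : ℕ} (i : Fin (n + 1)) : vee (vee i) = i := by
  unfold vee
  have := i.isLt
  split_ifs <;> simp_all [Fin.ext_iff] <;> omega

theorem bar_iterate_vee {n : ℕ} [NeZero n] (k : ℕ) (i : Fin (n + 1)) :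
    bar (vee^[k] i) = bar i := by
  induction k generalizing i with
  | zero => rfl
  | succ k ih => rw [Function.iterate_succ_apply, ih, bar_vee]

theorem map_bar_map_vee {n : ℕ} [NeZero n] (k : ℕ) (c : List (Fin (n + 1))) :
    (c.map vee^[k]).map bar = c.map bar := by
  rw [List.map_map]
  exact List.map_congr_left fun i _ => bar_iterate_vee k i

theorem iterate_vee_add_two {n : ℕ} (k : ℕ) (i : Fin (n + 1)) :
    vee^[k + 2] i = vee^[k] i := by
  rw [Function.iterate_add_apply]
  exact congrArg _ (vee_vee i)

theorem iterate_vee_add_even {n : ℕ} (k m : ℕ) (i : Fin (n + 1)) :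
    vee^[k + 2 * m] i = vee^[k] i := by
  induction m with
  | zero => rfl
  | succ m ih => rw [show k + 2 * (m + 1) = k + 2 * m + 2 by ring, iterate_vee_add_two, ih]

/-- This form of * continues the pattern of `twistedWord`: the block after the last one would be
twisted by ∨^{n+1}. -/
theorem star_eq_iterate_vee {n : ℕ} (i : Fin (n + 1)) : star i = vee^[n + 1] i := by
  unfold star
  split_ifs with h
  · obtain ⟨m, hm⟩ := h
    have h1 := iterate_vee_add_even 0 m i
    rw [show 0 + 2 * m = n + 1 by omega] at h1
    exact h1.symm
  · obtain ⟨m, hm⟩ := Nat.not_even_iff_odd.1 h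
    have h1 := iterate_vee_add_even 1 m i
    rw [show 1 + 2 * m = n + 1 by omega] at h1
    exact h1.symm

/-! Commutation equivalence. -/

theorem CommEquiv.rfl' {n : ℕ} (w : List (Fin (n + 1))) : CommEquiv w w := Relation.EqvGen.refl w

theorem CommEquiv.symm {n : ℕ} {w w' : List (Fin (n + 1))} (h : CommEquiv w w') :
    CommEquiv w' w := Relation.EqvGen.symm _ _ h

theorem CommEquiv.trans {n : ℕ} {w w' w'' : List (Fin (n + 1))} (h : CommEquiv w w')
    (h' : CommEquiv w' w'') : CommEquiv w w'' := Relation.EqvGen.trans _ _ _ h h'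

theorem CommEquiv.lift {n : ℕ} {w w' : List (Fin (n + 1))}
    (f : List (Fin (n + 1)) → List (Fin (n + 1)))
    (hf : ∀ w w', CommMove w w' → CommEquiv (f w) (f w')) (h : CommEquiv w w') :
    CommEquiv (f w) (f w') := by
  induction h with
  | rel _ _ h => exact hf _ _ h
  | refl _ => exact .rfl' _
  | symm _ _ _ ih => exact ih.symm
  | trans _ _ _ _ _ ih ih' => exact ih.trans ih'

theorem CommEquiv.append_right {n : ℕ} {w w' : List (Fin (n + 1))} (h : CommEquiv w w')
    (x : List (Fin (n + 1))) : CommEquiv (w ++ x) (w' ++ x) := by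
  refine h.lift (· ++ x) ?_
  rintro _ _ ⟨u, v, i, j, hij⟩
  refine .rel _ _ ?_
  simpa using CommMove.swap u (v ++ x) i j hij

theorem CommEquiv.append_left {n : ℕ} {w w' : List (Fin (n + 1))} (h : CommEquiv w w')
    (x : List (Fin (n + 1))) : CommEquiv (x ++ w) (x ++ w') := by
  refine h.lift (x ++ ·) ?_
  rintro _ _ ⟨u, v, i, j, hij⟩
  refine .rel _ _ ?_
  simpa using CommMove.swap (x ++ u) v i j hij

theorem CommEquiv.append {n : ℕ} {w w' x x' : List (Fin (n + 1))} (h : CommEquiv w w')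
    (h' : CommEquiv x x') : CommEquiv (w ++ x) (w' ++ x') :=
  (h.append_right x).trans (h'.append_left w')

theorem CommEquiv.reverse {n : ℕ} {w w' : List (Fin (n + 1))} (h : CommEquiv w w') :
    CommEquiv w.reverse w'.reverse := by
  refine h.lift List.reverse ?_
  rintro _ _ ⟨u, v, i, j, hij⟩
  refine .rel _ _ ?_
  rw [dynkinAdj_comm] at hij
  simpa using CommMove.swap v.reverse u.reverse j i hij

theorem CommEquiv.map_vee {n : ℕ} [NeZero n] (hn : 2 ≤ n) (k : ℕ) {w w' : List (Fin (n + 1))}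
    (h : CommEquiv w w') : CommEquiv (w.map vee^[k]) (w'.map vee^[k]) := by
  refine h.lift (List.map vee^[k]) ?_
  rintro _ _ ⟨u, v, i, j, hij⟩
  refine .rel _ _ ?_
  have hij' : ¬ DynkinAdj (vee^[k] i) (vee^[k] j) := by
    rwa [dynkinAdj_iff hn, bar_iterate_vee, bar_iterate_vee, ← dynkinAdj_iff hn]
  simpa using CommMove.swap (u.map vee^[k]) (v.map vee^[k]) _ _ hij'

/-- Deleting the first `a` from both sides of a swap leaves a swap or two equal words. It serves to
cancel a common first letter. -/
theorem CommEquiv.erase {n : ℕ} {w w' : List (Fin (n + 1))} (h : CommEquiv w w')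
    (a : Fin (n + 1)) : CommEquiv (w.erase a) (w'.erase a) := by
  refine h.lift (List.erase · a) ?_
  rintro _ _ ⟨u, v, i, j, hij⟩
  by_cases ha : a ∈ u
  · simp only [List.erase_append_left _ ha]
    exact .rel _ _ (.swap _ _ _ _ hij)
  simp only [List.erase_append_right _ ha]
  refine CommEquiv.append_left ?_ u
  by_cases hi : i = a
  · by_cases hj : j = a
    · subst hi hj
      exact .rfl' _
    · subst hi
      rw [List.erase_cons_head, List.erase_cons_tail (by simpa using hj), List.erase_cons_head]
      exact .rfl' _
  · by_cases hj : j = a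
    · subst hj
      rw [List.erase_cons_head, List.erase_cons_tail (by simpa using hi), List.erase_cons_head]
      exact .rfl' _
    · rw [List.erase_cons_tail (by simpa using hi), List.erase_cons_tail (by simpa using hj),
        List.erase_cons_tail (by simpa using hj), List.erase_cons_tail (by simpa using hi)]
      exact .rel _ _ (.swap [] _ _ _ hij)

theorem CommEquiv.of_cons {n : ℕ} {w w' : List (Fin (n + 1))} {i : Fin (n + 1)}
    (h : CommEquiv (i :: w) (i :: w')) : CommEquiv w w' := by
  simpa using h.erase i

/-- The subword in two letters that do not commute is an invariant of the commutation class. -/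
theorem CommEquiv.filter_eq {n : ℕ} {w w' : List (Fin (n + 1))} (h : CommEquiv w w')
    {i j : Fin (n + 1)} (hij : DynkinAdj i j) :
    w.filter (fun x => x = i ∨ x = j) = w'.filter (fun x => x = i ∨ x = j) := by
  induction h with
  | rel _ _ h =>
    obtain ⟨u, v, a, b, hab⟩ := h
    have hba : ¬ DynkinAdj b a := by rwa [dynkinAdj_comm]
    simp only [List.filter_append, List.filter_cons]
    by_cases ha : a = i ∨ a = j <;> by_cases hb : b = i ∨ b = j <;> simp only [ha, hb] <;>
      try rfl
    rcases ha with rfl | rfl <;> rcases hb with rfl | rfl <;> first | rfl | contradiction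
  | refl _ => rfl
  | symm _ _ _ ih => exact ih.symm
  | trans _ _ _ _ _ ih ih' => exact ih.trans ih'

/-- Were some j in `x` adjacent to i, the subword in the letters i, j would begin with j on the left
and with i on the right, against `filter_eq`. -/
theorem CommEquiv.not_adj_of_cons {n : ℕ} {x y u : List (Fin (n + 1))} {i : Fin (n + 1)}
    (h : CommEquiv (x ++ y) (i :: u)) (hi : i ∉ x) : ∀ j ∈ x, ¬ DynkinAdj i j := by
  intro j hj hij
  have hf := h.filter_eq hij
  rw [List.filter_append, List.filter_cons_of_pos (by simp)] at hf
  rcases hx : x.filter (fun x => x = i ∨ x = j) with _ | ⟨a, l⟩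
  · have : j ∈ x.filter (fun x => x = i ∨ x = j) := by simp [hj]
    rw [hx] at this
    simp at this
  · rw [hx, List.cons_append, List.cons.injEq] at hf
    have : a ∈ x.filter (fun x => x = i ∨ x = j) := by rw [hx]; simp
    rw [hf.1] at this
    exact hi (List.mem_of_mem_filter this)

theorem commEquiv_cons_of_commute {n : ℕ} (p q : List (Fin (n + 1))) (i : Fin (n + 1))
    (h : ∀ j ∈ p, ¬ DynkinAdj i j) : CommEquiv (p ++ i :: q) (i :: (p ++ q)) := by
  induction p with
  | nil => exact .rfl' _
  | cons a p ih =>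
    have h1 := (ih fun j hj => h j (by simp [hj])).append_left [a]
    refine CommEquiv.trans h1 (CommEquiv.symm (.rel _ _ ?_))
    exact .swap [] _ _ _ (h a (by simp))

/-! Twisted Coxeter words and reflection functors. -/

/-- Regrouping: the leading letter ∨^{k+1}(i) of each block moves to the end of the preceding block
as ∨^k(i^∨), and the appended letter completes the last block. -/
theorem flatMap_range_cons_append {n : ℕ} (m : ℕ) (i : Fin (n + 1)) (c : List (Fin (n + 1))) :
    ((List.range m).flatMap fun k => (i :: c).map (vee^[k])) ++ [vee^[m] i] =
      i :: (List.range m).flatMap fun k => (c ++ [vee i]).map (vee^[k]) := by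
  induction m with
  | zero => simp
  | succ m ih =>
    rw [List.range_succ, List.flatMap_append, List.flatMap_append, ← List.cons_append, ← ih]
    simp

theorem twistedWord_cons_append {n : ℕ} (i : Fin (n + 1)) (c : List (Fin (n + 1))) :
    twistedWord (i :: c) ++ [star i] = i :: twistedWord (c ++ [vee i]) := by
  rw [star_eq_iterate_vee]
  exact flatMap_range_cons_append _ _ _

theorem CommEquiv.twistedWord {n : ℕ} [NeZero n] (hn : 2 ≤ n) {c c' : List (Fin (n + 1))}
    (h : CommEquiv c c') : CommEquiv (twistedWord c) (twistedWord c') := by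
  unfold TwistedD.twistedWord
  induction List.range (n + 1) with
  | nil => exact .rfl' _
  | cons k l ih =>
    rw [List.flatMap_cons, List.flatMap_cons]
    exact (h.map_vee hn k).append ih

/-- Read backwards, the block in position k carries the twist n − k, which has the parity of n + k;
the constant ∨^n is absorbed into `c`. This reduces sources to sinks. -/
theorem twistedWord_reverse {n : ℕ} (c : List (Fin (n + 1))) :
    (twistedWord c).reverse = twistedWord (c.map vee^[n]).reverse := by
  unfold twistedWord
  rw [List.reverse_flatMap, List.range_eq_range', List.reverse_range', List.flatMap_map,
    ← List.range_eq_range']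
  refine List.flatMap_congr fun k hk => ?_
  rw [List.mem_range] at hk
  simp only [Function.comp, List.map_reverse, List.map_map]
  congr 1
  refine List.map_congr_left fun i _ => ?_
  rw [Function.comp_apply, ← Function.iterate_add_apply, ← iterate_vee_add_even _ k,
    show 0 + (n + 1) - 1 - k + 2 * k = k + n by omega]

theorem IsTwistedCoxeterWord.reverse {n : ℕ} [NeZero n] {c : List (Fin (n + 1))}
    (h : IsTwistedCoxeterWord c) : IsTwistedCoxeterWord (c.map vee^[n]).reverse := by
  unfold IsTwistedCoxeterWord at *
  rw [List.map_reverse, map_bar_map_vee]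
  exact (List.reverse_perm _).trans h

theorem IsTwistedCoxeterWord.exists_mem {n : ℕ} [NeZero n] {c : List (Fin (n + 1))}
    (h : IsTwistedCoxeterWord c) (b : Fin n) : ∃ i ∈ c, bar i = b :=
  List.mem_map.1 (h.symm.subset (List.mem_finRange b))

theorem IsTwistedCoxeterWord.nodup_map_bar {n : ℕ} [NeZero n] {c : List (Fin (n + 1))}
    (h : IsTwistedCoxeterWord c) : (c.map bar).Nodup :=
  h.nodup_iff.2 (List.nodup_finRange n)

theorem twistedWord_eq_append {n : ℕ} (c : List (Fin (n + 1))) : ∃ y, twistedWord c = c ++ y := by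
  unfold twistedWord
  rw [List.range_succ_eq_map, List.flatMap_cons]
  exact ⟨_, by simp; rfl⟩

/-- The sink i can be moved to the front of `c` itself; reflecting there turns `c` into its cyclic
shift with i replaced by i^∨. -/
theorem exists_twistedWord_of_sink {n : ℕ} [NeZero n] (hn : 2 ≤ n) {c u : List (Fin (n + 1))}
    {i : Fin (n + 1)} (hc : IsTwistedCoxeterWord c) (h : CommEquiv (twistedWord c) (i :: u)) :
    ∃ c', IsTwistedCoxeterWord c' ∧ CommEquiv (u ++ [star i]) (twistedWord c') := by
  obtain ⟨y, hy⟩ := twistedWord_eq_append c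
  have hic : i ∈ c := by
    -- Otherwise the letter of `c` in the orbit of i is i^∨ ≠ i, so this is the last orbit. The
    -- letter of `c` in the orbit before it is then adjacent to i and stands in front of it.
    by_contra hi
    rw [hy] at h
    have hadj := h.not_adj_of_cons hi
    obtain ⟨j, hj, hji⟩ := hc.exists_mem (bar i)
    have hbar : (bar i).val = n - 1 := by
      rcases (bar_eq_bar_iff _ _).1 hji with rfl | rfl
      · exact absurd hj hi
      · by_contra hne
        have : vee i = i := by
          have hne' : min i.val (n - 1) ≠ n - 1 := hne
          unfold vee
          rw [if_neg (by omega), if_neg (by omega)]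
        rw [this] at hj
        exact hi hj
    obtain ⟨k, hk, hki⟩ := hc.exists_mem ⟨n - 2, by omega⟩
    refine hadj k hk ((dynkinAdj_iff hn _ _).2 (Or.inr ?_))
    rw [hki, hbar]
    simp only
    omega
  obtain ⟨p, q, rfl, hip⟩ := List.eq_append_cons_of_mem hic
  have hp : ∀ j ∈ p, ¬ DynkinAdj i j := by
    rw [hy, List.append_assoc] at h
    exact h.not_adj_of_cons hip
  have h1 : CommEquiv (i :: u) (twistedWord (i :: (p ++ q))) :=
    h.symm.trans ((commEquiv_cons_of_commute p q i hp).twistedWord hn)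
  refine ⟨p ++ q ++ [vee i], ?_, ?_⟩
  · refine List.Perm.trans ?_ hc
    simp only [List.map_append, List.map_cons, List.map_nil, bar_vee]
    rw [List.append_assoc]
    exact (List.perm_append_singleton _ _).append_left _
  · refine CommEquiv.of_cons (i := i) ?_
    rw [← twistedWord_cons_append, ← List.cons_append]
    exact h1.append_right _

theorem IsTwistedAdapted.exists_twistedWord {n : ℕ} [NeZero n] (hn : 2 ≤ n)
    {w : List (Fin (n + 1))} (hw : IsTwistedAdapted w) :
    ∃ c, IsTwistedCoxeterWord c ∧ CommEquiv w (twistedWord c) := by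
  induction hw with
  | refl =>
    refine ⟨_, ?_, .rfl' _⟩
    unfold IsTwistedCoxeterWord
    rw [List.map_map]
    have : bar ∘ Fin.castSucc = (id : Fin n → Fin n) := by
      funext b
      have := b.isLt
      simp only [Function.comp, bar, Fin.ext_iff, Fin.val_castSucc, id]
      omega
    rw [this, List.map_id]
  | tail _ h ih =>
    obtain ⟨c, hc, hcw⟩ := ih
    rcases h with h | ⟨u, i, hw, hw'⟩ | ⟨u, i, hw, hw'⟩
    · exact ⟨c, hc, h.symm.trans hcw⟩
    · obtain ⟨c', hc', h'⟩ := exists_twistedWord_of_sink hn hc (hcw.symm.trans hw)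
      exact ⟨c', hc', hw'.trans h'⟩
    · have h1 := (hcw.symm.trans hw).reverse
      rw [twistedWord_reverse, List.reverse_append] at h1
      obtain ⟨c', hc', h'⟩ := exists_twistedWord_of_sink hn hc.reverse h1
      refine ⟨_, hc'.reverse, ?_⟩
      rw [← twistedWord_reverse]
      refine hw'.trans ?_
      simpa using h'.reverse

/-! Quivers and height functions. -/

/-- Arrows point to earlier letters, so the first letter is a sink; reversing there creates only
arrows out of a vertex that does not occur again. -/
theorem isAdaptedTo_of_idxOf_lt {n : ℕ} (w : List (Fin n)) (Q : Fin n → Fin n → Prop)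
    (hw : w.Nodup) (h : ∀ i ∈ w, ∀ j, Q i j → j ∈ w ∧ w.idxOf j < w.idxOf i) :
    IsAdaptedTo Q w := by
  induction w generalizing Q with
  | nil => trivial
  | cons a w ih =>
    rw [List.nodup_cons] at hw
    have ha : ∀ j, ¬ Q a j := fun j hj => by
      have := (h a (by simp) j hj).2
      simp at this
    refine ⟨ha, ih _ hw.2 fun i hi j hij => ?_⟩
    have hia : i ≠ a := fun e => hw.1 (e ▸ hi)
    unfold reverseAt at hij
    by_cases hja : j = a
    · rw [if_pos (Or.inr hja), hja] at hij
      exact absurd hij (ha i)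
    · rw [if_neg (by tauto)] at hij
      obtain ⟨h1, h2⟩ := h i (by simp [hi]) j hij
      rw [List.idxOf_cons_ne _ (Ne.symm hja), List.idxOf_cons_ne _ (Ne.symm hia)] at h2
      refine ⟨(List.mem_cons.1 h1).resolve_left hja, by omega⟩

theorem IsDynkinQuiver.exists_heightFunction {n : ℕ} {Q : Fin n → Fin n → Prop}
    (hQ : IsDynkinQuiver Q) : ∃ ξ, IsHeightFunction Q ξ := by
  classical
  -- Partial sums along the line: an arrow k → k+1 raises the height by one, the opposite arrow
  -- lowers it.
  refine ⟨fun i => ∑ k ∈ Finset.range i.val,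
    if ∃ (h : k < n) (h' : k + 1 < n), Q ⟨k, h⟩ ⟨k + 1, h'⟩ then 1 else -1, ?_⟩
  rintro ⟨i, hi⟩ ⟨j, hj⟩ hji
  rcases hQ.1 _ _ hji with h | h
  · simp only at h
    subst h
    simp only [Finset.sum_range_succ]
    rw [if_pos ⟨hj, hi, hji⟩]
  · simp only at h
    subst h
    simp only [Finset.sum_range_succ]
    rw [if_neg]
    · ring
    · rintro ⟨_, _, h⟩
      rcases hQ.2 ⟨i, hi⟩ ⟨i + 1, hj⟩ rfl with h' | h'
      · exact h'.2 hji
      · exact h'.2 h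

theorem IsTwistedCoxeterWord.exists_quiver {n : ℕ} [NeZero n] {c : List (Fin (n + 1))}
    (hc : IsTwistedCoxeterWord c) : ∃ Q : Fin n → Fin n → Prop,
      IsDynkinQuiver Q ∧ IsAdaptedTo Q (c.map bar) := by
  have hmem : ∀ b, b ∈ c.map bar := fun b => hc.symm.subset (List.mem_finRange b)
  -- Each edge points to the end whose letter comes first.
  refine ⟨fun i j => (i.val + 1 = j.val ∨ j.val + 1 = i.val) ∧
    (c.map bar).idxOf j < (c.map bar).idxOf i, ⟨fun i j h => h.1, fun i j hij => ?_⟩, ?_⟩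
  · have hne : (c.map bar).idxOf i ≠ (c.map bar).idxOf j := fun e => by
      have := (List.idxOf_inj (hmem i)).1 e
      subst this
      omega
    rcases lt_or_gt_of_ne hne with h | h
    · exact Or.inr ⟨⟨Or.inr hij, h⟩, fun h' => by omega⟩
    · exact Or.inl ⟨⟨Or.inl hij, h⟩, fun h' => by omega⟩
  · exact isAdaptedTo_of_idxOf_lt _ _ hc.nodup_map_bar fun i _ j h => ⟨hmem j, h.2⟩

theorem IsTwistedAdapted.exists_coordinateDatum {n : ℕ} [NeZero n] (hn : 2 ≤ n)
    {w : List (Fin (n + 1))} (hw : IsTwistedAdapted w) :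
    ∃ c Q ξ, IsCoordinateDatum w c Q ξ := by
  obtain ⟨c, hc, h⟩ := hw.exists_twistedWord hn
  obtain ⟨Q, hQ, hQc⟩ := hc.exists_quiver
  obtain ⟨ξ, hξ⟩ := hQ.exists_heightFunction
  exact ⟨c, Q, ξ, hc, h, hQ, hQc, hξ⟩

theorem IsDynkinQuiver.reverseAt {n : ℕ} {Q : Fin n → Fin n → Prop} (hQ : IsDynkinQuiver Q)
    (a : Fin n) : IsDynkinQuiver (reverseAt Q a) := by
  refine ⟨fun i j h => ?_, fun i j hij => ?_⟩
  · unfold TwistedD.reverseAt at h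
    split_ifs at h
    · exact (hQ.1 _ _ h).symm
    · exact hQ.1 _ _ h
  · unfold TwistedD.reverseAt
    have := hQ.2 i j hij
    by_cases h : i = a ∨ j = a
    · rw [if_pos h, if_pos h.symm]
      exact (xor_comm _ _).mp this
    · rw [if_neg h, if_neg (by tauto)]
      exact this

/-- At its turn b is a sink, so the edge then points from b' to b. Earlier reversals did not touch
it, since neither end occurs before b. -/
theorem IsAdaptedTo.arrow {n : ℕ} {Q : Fin n → Fin n → Prop} {u v : List (Fin n)} {b b' : Fin n}
    (hQ : IsDynkinQuiver Q) (h : IsAdaptedTo Q (u ++ b :: v)) (hnd : (u ++ b :: v).Nodup)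
    (hb' : b' ∈ v) (hadj : b.val + 1 = b'.val ∨ b'.val + 1 = b.val) : Q b' b := by
  induction u generalizing Q with
  | nil =>
    rcases hadj with h' | h'
    · rcases hQ.2 _ _ h' with h2 | h2
      · exact absurd h2.1 (h.1 _)
      · exact h2.1
    · rcases hQ.2 _ _ h' with h2 | h2
      · exact h2.1
      · exact absurd h2.1 (h.1 _)
  | cons a u ih =>
    rw [List.cons_append, List.nodup_cons] at hnd
    have h1 := ih (hQ.reverseAt a) h.2 hnd.2
    unfold reverseAt at h1
    rwa [if_neg] at h1
    rintro (rfl | rfl) <;> apply hnd.1 <;> simp [hb']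

/-! ### Roots as integer vectors of square length 2; heights and coweights -/

theorem exists_of_sum_sq_eq_one {ι : Type*} [DecidableEq ι] {s : Finset ι} {v : ι → ℤ}
    (h : ∑ a ∈ s, v a * v a = 1) :
    ∃ b ∈ s, (v b = 1 ∨ v b = -1) ∧ ∀ c ∈ s, c ≠ b → v c = 0 := by
  obtain ⟨b, hb, hvb⟩ := Finset.exists_ne_zero_of_sum_ne_zero (h.trans_ne one_ne_zero)
  rw [← Finset.add_sum_erase _ _ hb] at h
  have hnn : ∀ c ∈ s.erase b, 0 ≤ v c * v c := fun c _ => mul_self_nonneg _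
  have hpos : 0 < v b * v b := lt_of_le_of_ne (mul_self_nonneg _) (Ne.symm hvb)
  have hsum := Finset.sum_nonneg hnn
  have h0 : ∑ c ∈ s.erase b, v c * v c = 0 := by omega
  refine ⟨b, hb, mul_self_eq_one_iff.1 (by omega), fun c hc hcb => ?_⟩
  exact mul_self_eq_zero.1 ((Finset.sum_eq_zero_iff_of_nonneg hnn).1 h0 c
    (Finset.mem_erase.2 ⟨hcb, hc⟩))

theorem exists_eps_of_dotProduct_self_eq_one {n : ℕ} {v : Fin (n + 1) → ℤ} (h : v ⬝ᵥ v = 1) :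
    ∃ a, v = eps a ∨ v = -eps a := by
  obtain ⟨b, -, hb, h0⟩ := exists_of_sum_sq_eq_one h
  refine ⟨b, hb.imp (fun hb => ?_) fun hb => ?_⟩ <;> funext c <;> by_cases hc : c = b
  all_goals first
    | subst hc; simp [eps, hb]
    | simp [eps, h0 c (Finset.mem_univ _) hc, hc]

theorem mem_posRoots {n : ℕ} {v : Fin (n + 1) → ℤ} :
    v ∈ posRoots n ↔ ∃ a b, a < b ∧ (v = eps a - eps b ∨ v = eps a + eps b) := by
  simp only [posRoots, Finset.mem_union, Finset.mem_image, Finset.mem_filter, Finset.mem_univ,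
    true_and, Prod.exists]
  constructor
  · rintro (⟨a, b, h, rfl⟩ | ⟨a, b, h, rfl⟩)
    · exact ⟨a, b, h, Or.inl rfl⟩
    · exact ⟨a, b, h, Or.inr rfl⟩
  · rintro ⟨a, b, h, rfl | rfl⟩
    · exact Or.inl ⟨a, b, h, rfl⟩
    · exact Or.inr ⟨a, b, h, rfl⟩

/-- An integer vector of square length 2 has exactly two nonzero entries, both ±1. -/
theorem mem_posRoots_or_neg_mem {n : ℕ} {v : Fin (n + 1) → ℤ} (h : v ⬝ᵥ v = 2) :
    v ∈ posRoots n ∨ -v ∈ posRoots n := by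
  have hne : ∑ a, v a * v a ≠ 0 := by
    intro h0
    have := h.symm.trans h0
    omega
  obtain ⟨a, -, hva⟩ := Finset.exists_ne_zero_of_sum_ne_zero hne
  have hs : v a * v a + ∑ c ∈ Finset.univ.erase a, v c * v c = 2 := by
    exact (Finset.add_sum_erase _ (fun c => v c * v c) (Finset.mem_univ a)).trans h
  have hsum : 0 ≤ ∑ c ∈ Finset.univ.erase a, v c * v c :=
    Finset.sum_nonneg fun c _ => mul_self_nonneg _
  have hva0 : v a ≠ 0 := fun h => hva (by rw [h, zero_mul])
  have ha : v a = 1 ∨ v a = -1 := by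
    have h1 : v a ≤ 1 := by nlinarith
    have h2 : -1 ≤ v a := by nlinarith
    omega
  have h1 : ∑ c ∈ Finset.univ.erase a, v c * v c = 1 := by
    rcases ha with ha | ha <;> rw [ha] at hs <;> omega
  obtain ⟨b, hb, hvb, h0⟩ := exists_of_sum_sq_eq_one h1
  have hab : b ≠ a := (Finset.mem_erase.1 hb).1
  have hv : v = v a • eps a + v b • eps b := by
    funext c
    by_cases hca : c = a
    · subst hca
      simp [eps, hab.symm]
    · by_cases hcb : c = b
      · subst hcb
        simp [eps, hab]
      · simp [eps, hca, hcb, h0 c (Finset.mem_erase.2 ⟨hca, Finset.mem_univ _⟩) hcb]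
  have key : ∀ (a b : Fin (n + 1)) (x y : ℤ), a < b → (x = 1 ∨ x = -1) → (y = 1 ∨ y = -1) →
      v = x • eps a + y • eps b → v ∈ posRoots n ∨ -v ∈ posRoots n := by
    rintro a b x y hab (rfl | rfl) (rfl | rfl) rfl
    · exact Or.inl (mem_posRoots.2 ⟨a, b, hab, Or.inr (by simp)⟩)
    · exact Or.inl (mem_posRoots.2 ⟨a, b, hab, Or.inl (by simp [sub_eq_add_neg])⟩)
    · exact Or.inr (mem_posRoots.2 ⟨a, b, hab, Or.inl (by simp [sub_eq_add_neg, add_comm])⟩)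
    · exact Or.inr (mem_posRoots.2 ⟨a, b, hab, Or.inr (by simp [add_comm])⟩)
  rcases lt_or_gt_of_ne hab with h | h
  · exact key b a _ _ h hvb ha (hv.trans (add_comm _ _))
  · exact key a b _ _ h ha hvb hv

theorem dotProduct_self_of_mem_posRoots {n : ℕ} {v : Fin (n + 1) → ℤ} (h : v ∈ posRoots n) :
    v ⬝ᵥ v = 2 := by
  obtain ⟨a, b, hab, rfl | rfl⟩ := mem_posRoots.1 h <;>
    simp [eps, dotProduct_sub, dotProduct_add, hab.ne, hab.ne']

/-- Twice the fundamental coweights. -/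
def coweight {n : ℕ} (i a : Fin (n + 1)) : ℤ :=
  if i.val + 1 < n then if a ≤ i then 2 else 0
  else if a.val < n then 1 else if i.val = n then 1 else -1

theorem coweight_dotProduct_simpleRoot {n : ℕ} (hn : 2 ≤ n) (i j : Fin (n + 1)) :
    coweight i ⬝ᵥ simpleRoot j = if j = i then 2 else 0 := by
  have hi := i.isLt
  have hj := j.isLt
  rw [dotProduct_simpleRoot]
  unfold coweight
  simp only [Fin.ext_iff, Fin.le_def, Fin.val_last]
  split_ifs <;> omega

theorem coweight_dotProduct_nonneg {n : ℕ} (i : Fin (n + 1)) {v : Fin (n + 1) → ℤ}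
    (hv : v ∈ posRoots n) : 0 ≤ coweight i ⬝ᵥ v := by
  obtain ⟨a, b, hab, rfl | rfl⟩ := mem_posRoots.1 hv <;>
    simp only [eps, dotProduct_sub, dotProduct_add, dotProduct_single, mul_one] <;>
    unfold coweight <;> simp only [Fin.le_def, Fin.lt_def] at * <;> split_ifs <;> omega

/-- The pairing with the sum of the fundamental coweights. -/
def rootHeight {n : ℕ} (v : Fin (n + 1) → ℤ) : ℤ := (fun a : Fin (n + 1) => (n : ℤ) - a.val) ⬝ᵥ v

theorem rootHeight_neg {n : ℕ} (v : Fin (n + 1) → ℤ) : rootHeight (-v) = -rootHeight v := by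
  simp [rootHeight]

theorem rootHeight_pos {n : ℕ} {v : Fin (n + 1) → ℤ} (hv : v ∈ posRoots n) :
    0 < rootHeight v := by
  obtain ⟨a, b, hab, rfl | rfl⟩ := mem_posRoots.1 hv <;>
    simp only [rootHeight, eps, dotProduct_sub, dotProduct_add, dotProduct_single, mul_one] <;>
    have := b.isLt <;> rw [Fin.lt_def] at hab <;> omega

theorem mem_posRoots_iff {n : ℕ} {v : Fin (n + 1) → ℤ} :
    v ∈ posRoots n ↔ v ⬝ᵥ v = 2 ∧ 0 < rootHeight v := by
  refine ⟨fun h => ⟨dotProduct_self_of_mem_posRoots h, rootHeight_pos h⟩, fun ⟨h, h'⟩ => ?_⟩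
  refine (mem_posRoots_or_neg_mem h).resolve_right fun h2 => ?_
  have := rootHeight_pos h2
  rw [rootHeight_neg] at this
  omega

theorem rootHeight_ne_zero {n : ℕ} {v : Fin (n + 1) → ℤ} (h : v ⬝ᵥ v = 2) :
    rootHeight v ≠ 0 := by
  rcases mem_posRoots_or_neg_mem h with h | h
  · exact (rootHeight_pos h).ne'
  · have := rootHeight_pos h
    rw [rootHeight_neg] at this
    omega

theorem simpleRoot_dotProduct_self {n : ℕ} (hn : 2 ≤ n) (i : Fin (n + 1)) :
    simpleRoot i ⬝ᵥ simpleRoot i = 2 := by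
  have hi := i.isLt
  rw [dotProduct_simpleRoot]
  simp only [simpleRoot, eps]
  split_ifs <;>
    simp only [Pi.sub_apply, Pi.add_apply, Pi.single_apply, Fin.ext_iff, Fin.val_last] <;>
    split_ifs <;> omega

theorem rootHeight_simpleRoot {n : ℕ} (hn : 2 ≤ n) (i : Fin (n + 1)) :
    rootHeight (simpleRoot i) = 1 := by
  have hi := i.isLt
  unfold rootHeight
  rw [dotProduct_simpleRoot]
  split_ifs <;> simp only [Fin.val_last] <;> omega

theorem refl_dotProduct_refl {n : ℕ} (hn : 2 ≤ n) (i : Fin (n + 1)) (v w : Fin (n + 1) → ℤ) :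
    refl i v ⬝ᵥ refl i w = v ⬝ᵥ w := by
  have h := simpleRoot_dotProduct_self hn i
  have h' := dotProduct_comm (simpleRoot i) w
  simp only [refl, dotProduct_sub, sub_dotProduct, dotProduct_smul, smul_dotProduct, smul_eq_mul,
    h, h']
  ring

/-- s_i lowers the height by v·α_i, which is at most 1 because |v − α_i|² > 0. So the height stays
nonnegative, and no root has height 0. -/
theorem refl_mem_posRoots {n : ℕ} (hn : 2 ≤ n) (i : Fin (n + 1)) {v : Fin (n + 1) → ℤ}
    (hv : v ∈ posRoots n) (hne : v ≠ simpleRoot i) : refl i v ∈ posRoots n := by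
  have h2 := dotProduct_self_of_mem_posRoots hv
  have hi := simpleRoot_dotProduct_self hn i
  have hr : refl i v ⬝ᵥ refl i v = 2 := by rw [refl_dotProduct_refl hn, h2]
  have hlt : v ⬝ᵥ simpleRoot i < 2 := by
    have h0 : 0 ≤ (v - simpleRoot i) ⬝ᵥ (v - simpleRoot i) :=
      Finset.sum_nonneg fun a _ => mul_self_nonneg _
    have h1 : (v - simpleRoot i) ⬝ᵥ (v - simpleRoot i) ≠ 0 := fun h =>
      hne (sub_eq_zero.1 (dotProduct_self_eq_zero.1 h))
    simp only [dotProduct_sub, sub_dotProduct, h2, hi, dotProduct_comm (simpleRoot i) v] at h0 h1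
    omega
  have hH : rootHeight (refl i v) = rootHeight v - v ⬝ᵥ simpleRoot i := by
    have := rootHeight_simpleRoot hn i
    unfold rootHeight at *
    simp only [refl, dotProduct_sub, dotProduct_smul, smul_eq_mul, this, mul_one]
  have := rootHeight_pos hv
  have := rootHeight_ne_zero hr
  exact mem_posRoots_iff.2 ⟨hr, by omega⟩

/-! The linear maps. -/

/-- The simple reflection as a linear automorphism. -/
def reflEquiv {n : ℕ} (hn : 2 ≤ n) (i : Fin (n + 1)) :
    (Fin (n + 1) → ℤ) ≃ₗ[ℤ] (Fin (n + 1) → ℤ) :=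
  LinearEquiv.ofInvolutive
    { toFun := refl i
      map_add' := fun v w => by simp only [refl, add_dotProduct, add_smul]; abel
      map_smul' := fun r v => by
        simp only [refl, smul_dotProduct, smul_sub, smul_eq_mul, mul_smul, RingHom.id_apply] }
    fun v => by
      have h := simpleRoot_dotProduct_self hn i
      simp only [LinearMap.coe_mk, AddHom.coe_mk, refl, sub_dotProduct, smul_dotProduct, h,
        smul_eq_mul]
      module

/-- Change of sign of the last coordinate, which induces the diagram automorphism. -/
def lastNeg {n : ℕ} : (Fin (n + 1) → ℤ) ≃ₗ[ℤ] (Fin (n + 1) → ℤ) :=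
  LinearEquiv.ofInvolutive
    { toFun := fun v a => if a.val = n then -v a else v a
      map_add' := fun v w => by
        funext a
        simp only [Pi.add_apply]
        split_ifs <;> ring
      map_smul' := fun r v => by
        funext a
        simp only [Pi.smul_apply, smul_eq_mul, RingHom.id_apply]
        split_ifs <;> ring }
    fun v => by
      funext a
      simp only [LinearMap.coe_mk, AddHom.coe_mk]
      split_ifs <;> ring

theorem lastNeg_apply {n : ℕ} (v : Fin (n + 1) → ℤ) (a : Fin (n + 1)) :
    lastNeg v a = if a.val = n then -v a else v a := rfl

theorem lastNeg_lastNeg {n : ℕ} (v : Fin (n + 1) → ℤ) : lastNeg (lastNeg v) = v := by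
  funext a
  simp only [lastNeg_apply]
  split_ifs <;> ring

theorem lastNeg_dotProduct {n : ℕ} (v w : Fin (n + 1) → ℤ) :
    lastNeg v ⬝ᵥ w = v ⬝ᵥ lastNeg w := by
  unfold dotProduct
  refine Finset.sum_congr rfl fun a _ => ?_
  simp only [lastNeg_apply]
  split_ifs <;> ring

theorem rootHeight_lastNeg {n : ℕ} (v : Fin (n + 1) → ℤ) :
    rootHeight (lastNeg v) = rootHeight v := by
  unfold rootHeight dotProduct
  refine Finset.sum_congr rfl fun a _ => ?_
  simp only [lastNeg_apply]
  split_ifs with h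
  · simp [h]
  · rfl

theorem lastNeg_simpleRoot {n : ℕ} (hn : 2 ≤ n) (i : Fin (n + 1)) :
    lastNeg (simpleRoot i) = simpleRoot (vee i) := by
  funext a
  have hi := i.isLt
  rw [lastNeg_apply]
  unfold vee
  split_ifs <;> simp only [simpleRoot, eps] <;> split_ifs <;>
    simp only [Pi.sub_apply, Pi.add_apply, Pi.single_apply, Fin.ext_iff, Fin.val_last] at * <;>
    have := Fin.val_last n <;> split_ifs <;> omega

theorem lastNeg_refl {n : ℕ} (hn : 2 ≤ n) (i : Fin (n + 1)) (v : Fin (n + 1) → ℤ) :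
    lastNeg (refl i v) = refl (vee i) (lastNeg v) := by
  unfold refl
  rw [map_sub, map_smul, lastNeg_simpleRoot hn, ← lastNeg_simpleRoot hn, lastNeg_dotProduct,
    lastNeg_lastNeg]

theorem act_append {n : ℕ} (u w : List (Fin (n + 1))) (v : Fin (n + 1) → ℤ) :
    act (u ++ w) v = act u (act w v) := by
  simp [act, List.foldr_append]

theorem act_map_vee {n : ℕ} (hn : 2 ≤ n) (w : List (Fin (n + 1))) (v : Fin (n + 1) → ℤ) :
    act (w.map vee) v = lastNeg (act w (lastNeg v)) := by
  induction w with
  | nil => exact (lastNeg_lastNeg v).symm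
  | cons i w ih =>
    change refl (vee i) (act (w.map vee) v) = lastNeg (refl i (act w (lastNeg v)))
    rw [ih, lastNeg_refl hn]

/-- The action of a word as a linear automorphism. -/
def actEquiv {n : ℕ} (hn : 2 ≤ n) (w : List (Fin (n + 1))) :
    (Fin (n + 1) → ℤ) ≃ₗ[ℤ] (Fin (n + 1) → ℤ) :=
  (w.map (reflEquiv hn)).prod

theorem actEquiv_apply {n : ℕ} (hn : 2 ≤ n) (w : List (Fin (n + 1))) (v : Fin (n + 1) → ℤ) :
    actEquiv hn w v = act w v := by
  induction w with
  | nil => rfl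
  | cons i w ih =>
    change reflEquiv hn i (actEquiv hn w v) = refl i (act w v)
    rw [ih]
    rfl

theorem act_sub_smul {n : ℕ} (hn : 2 ≤ n) (w : List (Fin (n + 1))) (v x : Fin (n + 1) → ℤ)
    (r : ℤ) : act w (v - r • x) = act w v - r • act w x := by
  simp only [← actEquiv_apply hn, map_sub, map_smul]

theorem act_dotProduct_act {n : ℕ} (hn : 2 ≤ n) (w : List (Fin (n + 1)))
    (v x : Fin (n + 1) → ℤ) : act w v ⬝ᵥ act w x = v ⬝ᵥ x := by
  induction w with
  | nil => rfl
  | cons i w ih => exact (refl_dotProduct_refl hn i _ _).trans ih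

/-- A negative root that a word maps to a positive one is mapped to one of the roots
`s_{i_1} ⋯ s_{i_{k-1}} (α_{i_k})`. -/
theorem exists_act_eq_of_neg {n : ℕ} (hn : 2 ≤ n) (w : List (Fin (n + 1)))
    {x : Fin (n + 1) → ℤ} (hx : -x ∈ posRoots n) (hw : act w x ∈ posRoots n) :
    ∃ u i v, w = u ++ i :: v ∧ act w x = act u (simpleRoot i) := by
  induction w with
  | nil =>
    have h1 := rootHeight_pos hx
    have h2 := rootHeight_pos hw
    rw [rootHeight_neg] at h1
    change 0 < rootHeight x at h2
    omega
  | cons i w ih =>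
    have h2 : act w x ⬝ᵥ act w x = 2 := by
      rw [act_dotProduct_act hn]
      simpa using dotProduct_self_of_mem_posRoots hx
    rcases mem_posRoots_or_neg_mem h2 with h | h
    · obtain ⟨u, j, v, rfl, huv⟩ := ih h
      exact ⟨i :: u, j, v, rfl, congrArg (refl i) huv⟩
    · have hneg : refl i (-act w x) = -refl i (act w x) := map_neg (reflEquiv hn i) _
      refine ⟨[], i, w, rfl, ?_⟩
      -- The sign changes at this letter, and the only negative root that s_i makes positive is
      -- −α_i.
      by_cases he : -act w x = simpleRoot i
      · have h3 : refl i (simpleRoot i) = -simpleRoot i := by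
          unfold refl
          rw [simpleRoot_dotProduct_self hn]
          module
        rw [he, h3] at hneg
        exact (neg_injective hneg).symm
      · have h3 := rootHeight_pos (refl_mem_posRoots hn i h he)
        have h4 : 0 < rootHeight (refl i (act w x)) := rootHeight_pos hw
        rw [hneg, rootHeight_neg] at h3
        omega

/-- A reflection s_j with j ≠ i does not change the coefficient of α_i. -/
theorem dotProduct_act_of_notMem {n : ℕ} (hn : 2 ≤ n) (i : Fin (n + 1))
    (w : List (Fin (n + 1))) (hi : i ∉ w) (v : Fin (n + 1) → ℤ) :
    coweight i ⬝ᵥ act w v = coweight i ⬝ᵥ v := by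
  induction w with
  | nil => rfl
  | cons j w ih =>
    rw [List.mem_cons, not_or] at hi
    change coweight i ⬝ᵥ refl j (act w v) = _
    unfold refl
    rw [dotProduct_sub, dotProduct_smul, coweight_dotProduct_simpleRoot hn,
      if_neg (Ne.symm hi.1), ih hi.2]
    simp

/-- The coefficient of α_i in the image is still 1, which excludes a negative root. -/
theorem act_simpleRoot_mem_posRoots {n : ℕ} (hn : 2 ≤ n) (i : Fin (n + 1))
    (w : List (Fin (n + 1))) (hi : i ∉ w) : act w (simpleRoot i) ∈ posRoots n := by
  have h2 : act w (simpleRoot i) ⬝ᵥ act w (simpleRoot i) = 2 := by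
    rw [act_dotProduct_act hn, simpleRoot_dotProduct_self hn]
  refine (mem_posRoots_or_neg_mem h2).resolve_right fun h => ?_
  have h1 := coweight_dotProduct_nonneg i h
  rw [dotProduct_neg, dotProduct_act_of_notMem hn i w hi, coweight_dotProduct_simpleRoot hn,
    if_pos rfl] at h1
  omega

/-! ### Twisted Coxeter words: letters and the first slice -/

/-- The letter of a twisted Coxeter word in a given orbit. -/
noncomputable def IsTwistedCoxeterWord.letter {n : ℕ} [NeZero n] {c : List (Fin (n + 1))}
    (hc : IsTwistedCoxeterWord c) (b : Fin n) : Fin (n + 1) :=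
  (hc.exists_mem b).choose

theorem IsTwistedCoxeterWord.letter_mem {n : ℕ} [NeZero n] {c : List (Fin (n + 1))}
    (hc : IsTwistedCoxeterWord c) (b : Fin n) : hc.letter b ∈ c :=
  (hc.exists_mem b).choose_spec.1

theorem IsTwistedCoxeterWord.bar_letter {n : ℕ} [NeZero n] {c : List (Fin (n + 1))}
    (hc : IsTwistedCoxeterWord c) (b : Fin n) : bar (hc.letter b) = b :=
  (hc.exists_mem b).choose_spec.2

theorem IsTwistedCoxeterWord.letter_bar {n : ℕ} [NeZero n] {c : List (Fin (n + 1))}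
    (hc : IsTwistedCoxeterWord c) {i : Fin (n + 1)} (hi : i ∈ c) : hc.letter (bar i) = i :=
  List.inj_on_of_nodup_map hc.nodup_map_bar (hc.letter_mem _) hi (hc.bar_letter _)

theorem IsTwistedCoxeterWord.nodup {n : ℕ} [NeZero n] {c : List (Fin (n + 1))}
    (hc : IsTwistedCoxeterWord c) : c.Nodup := hc.nodup_map_bar.of_map

theorem IsTwistedCoxeterWord.letter_injective {n : ℕ} [NeZero n] {c : List (Fin (n + 1))}
    (hc : IsTwistedCoxeterWord c) : Function.Injective hc.letter := fun b b' h => by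
  rw [← hc.bar_letter b, h, hc.bar_letter]

/-- The root `s_{i_1} ⋯ s_{i_{k-1}} (α_{i_k})` for the first occurrence `i_k` of `i`. -/
def prefixRoot {n : ℕ} (c : List (Fin (n + 1))) (i : Fin (n + 1)) : Fin (n + 1) → ℤ :=
  act (c.takeWhile (· ≠ i)) (simpleRoot i)

theorem prefixRoot_append_cons {n : ℕ} (u v : List (Fin (n + 1))) (i : Fin (n + 1))
    (hi : i ∉ u) : prefixRoot (u ++ i :: v) i = act u (simpleRoot i) := by
  unfold prefixRoot
  rw [List.takeWhile_append_of_pos, List.takeWhile_cons_of_neg (by simp), List.append_nil]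
  intro a ha
  simpa using fun e : a = i => hi (e ▸ ha)

/-- Telescoping: appending i to the prefix u subtracts (x·α_i)u(α_i), and u(α_i) is a prefix root.
-/
theorem act_prefix {n : ℕ} (hn : 2 ≤ n) (u v : List (Fin (n + 1))) (h : (u ++ v).Nodup)
    (x : Fin (n + 1) → ℤ) :
    act u x = x - ∑ j ∈ u.toFinset, (x ⬝ᵥ simpleRoot j) • prefixRoot (u ++ v) j := by
  rw [List.sum_toFinset _ h.of_append_left]
  induction u using List.reverseRecOn generalizing v x with
  | nil => simp [act]
  | append_singleton u i ih =>
    rw [List.append_assoc] at h ⊢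
    have hi : i ∉ u := fun hi => (List.disjoint_of_nodup_append h) hi (by simp)
    have h1 : act (u ++ [i]) x = act u x - (x ⬝ᵥ simpleRoot i) • act u (simpleRoot i) := by
      rw [act_append, ← act_sub_smul hn]
      rfl
    rw [h1, ih _ h, List.map_append, List.sum_append]
    simp only [List.map_cons, List.map_nil, List.sum_singleton, List.cons_append, List.nil_append]
    rw [prefixRoot_append_cons _ _ _ hi, sub_sub]

/-- The orbits adjacent to a given one. -/
def neighbours {n : ℕ} (b : Fin n) : Finset (Fin n) :=
  Finset.univ.filter fun b' => b.val + 1 = b'.val ∨ b'.val + 1 = b.val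

theorem mem_neighbours {n : ℕ} {b b' : Fin n} :
    b' ∈ neighbours b ↔ b.val + 1 = b'.val ∨ b'.val + 1 = b.val := by
  simp [neighbours]

theorem sum_neighbours {n : ℕ} {M : Type*} [AddCommMonoid M] (b : Fin n) (f : Fin n → M) :
    ∑ b' ∈ neighbours b, f b' = (if h : b.val + 1 < n then f ⟨b.val + 1, h⟩ else 0) +
      if _h : 0 < b.val then f ⟨b.val - 1, by omega⟩ else 0 := by
  have hb := b.isLt
  have h1 : (neighbours b) = (Finset.univ.filter fun b' => b.val + 1 = b'.val) ∪
      Finset.univ.filter fun b' => b'.val + 1 = b.val := Finset.filter_or _ _ _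
  rw [h1, Finset.sum_union]
  · congr 1
    · split_ifs with h
      · rw [show (Finset.univ.filter fun b' : Fin n => b.val + 1 = b'.val) = {⟨b.val + 1, h⟩} by
          ext x
          simp [Fin.ext_iff, eq_comm], Finset.sum_singleton]
      · refine Finset.sum_eq_zero fun x hx => ?_
        have := x.isLt
        simp only [Finset.mem_filter] at hx
        omega
    · split_ifs with h
      · rw [show (Finset.univ.filter fun b' : Fin n => b'.val + 1 = b.val) =
            {⟨b.val - 1, by omega⟩} by
          ext x
          simp only [Finset.mem_filter, Finset.mem_univ, true_and, Finset.mem_singleton,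
            Fin.ext_iff]
          omega, Finset.sum_singleton]
      · refine Finset.sum_eq_zero fun x hx => ?_
        simp only [Finset.mem_filter] at hx
        omega
  · rw [Finset.disjoint_filter]
    intros
    omega

theorem simpleRoot_dotProduct_simpleRoot {n : ℕ} [NeZero n] (hn : 2 ≤ n) (i j : Fin (n + 1)) :
    simpleRoot i ⬝ᵥ simpleRoot j =
      if i = j then 2 else if bar j ∈ neighbours (bar i) then -1 else 0 := by
  have hi := i.isLt
  have hj := j.isLt
  rw [dotProduct_simpleRoot]
  simp only [simpleRoot, eps, mem_neighbours, bar, Fin.ext_iff]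
  split_ifs <;>
    simp only [Pi.sub_apply, Pi.add_apply, Pi.single_apply, Fin.ext_iff, Fin.val_last] at * <;>
    split_ifs <;> omega

/-- The twisted Coxeter element `(s_{i_1} ⋯ s_{i_n})∨`. -/
def coxeterEquiv {n : ℕ} (hn : 2 ≤ n) (c : List (Fin (n + 1))) :
    (Fin (n + 1) → ℤ) ≃ₗ[ℤ] (Fin (n + 1) → ℤ) := actEquiv hn c * lastNeg

theorem coxeterEquiv_apply {n : ℕ} (hn : 2 ≤ n) (c : List (Fin (n + 1))) (v : Fin (n + 1) → ℤ) :
    coxeterEquiv hn c v = act c (lastNeg v) := actEquiv_apply hn c _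

section

variable {n : ℕ} [NeZero n] {c : List (Fin (n + 1))}

/-- The roots in the first slice of the twisted AR-quiver, indexed by orbits. -/
noncomputable def IsTwistedCoxeterWord.root (hc : IsTwistedCoxeterWord c) (b : Fin n) :
    Fin (n + 1) → ℤ := prefixRoot c (hc.letter b)

theorem IsTwistedCoxeterWord.sum_letter (hc : IsTwistedCoxeterWord c) (u : List (Fin (n + 1)))
    (hu : u ⊆ c) (f : Fin (n + 1) → Fin (n + 1) → ℤ) :
    ∑ j ∈ u.toFinset, f j = ∑ b, if hc.letter b ∈ u then f (hc.letter b) else 0 := by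
  rw [← Finset.sum_filter, ← Finset.sum_image (s := Finset.univ.filter fun b => hc.letter b ∈ u)
    (g := hc.letter) (f := f) hc.letter_injective.injOn]
  congr 1
  ext j
  simp only [List.mem_toFinset, Finset.mem_image, Finset.mem_filter, Finset.mem_univ, true_and]
  constructor
  · exact fun hj => ⟨bar j, by rwa [hc.letter_bar (hu hj)], hc.letter_bar (hu hj)⟩
  · rintro ⟨b, hb, rfl⟩
    exact hb

theorem IsTwistedCoxeterWord.act_eq (hn : 2 ≤ n) (hc : IsTwistedCoxeterWord c)
    (x : Fin (n + 1) → ℤ) :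
    act c x = x - ∑ b, (x ⬝ᵥ simpleRoot (hc.letter b)) • hc.root b := by
  have h := act_prefix hn c [] (by simpa using hc.nodup) x
  rw [h, hc.sum_letter _ (List.Subset.refl c)]
  simp [hc.letter_mem, IsTwistedCoxeterWord.root]

end

/-! ### Heights and relations in the first slice -/

section

variable {n : ℕ} [NeZero n] {w c : List (Fin (n + 1))} {Q : Fin n → Fin n → Prop} {ξ : Fin n → ℤ}

theorem IsCoordinateDatum.height_of_append (h : IsCoordinateDatum w c Q ξ)
    {u v : List (Fin (n + 1))} {i j : Fin (n + 1)} (hc : c = u ++ i :: v) (hj : j ∈ v)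
    (hij : bar j ∈ neighbours (bar i)) : ξ (bar i) = ξ (bar j) + 1 := by
  have had := h.adapted
  have hnd := h.coxeter.nodup_map_bar
  rw [hc, List.map_append, List.map_cons] at had hnd
  exact h.height _ _ (had.arrow h.quiver hnd (List.mem_map_of_mem hj) (mem_neighbours.1 hij))

theorem IsCoordinateDatum.height_neighbour (h : IsCoordinateDatum w c Q ξ) {b b' : Fin n}
    (hb : b' ∈ neighbours b) : ξ b' = ξ b + 1 ∨ ξ b' = ξ b - 1 := by
  rcases mem_neighbours.1 hb with hb | hb
  · rcases h.quiver.2 _ _ hb with h' | h'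
    · exact Or.inl (h.height _ _ h'.1)
    · exact Or.inr (by rw [h.height _ _ h'.1]; ring)
  · rcases h.quiver.2 _ _ hb with h' | h'
    · exact Or.inr (by rw [h.height _ _ h'.1]; ring)
    · exact Or.inl (h.height _ _ h'.1)

/-- Edges point to the earlier letter, so the height function records the order of neighbouring
orbits in `c`. -/
theorem IsCoordinateDatum.letter_mem_iff (h : IsCoordinateDatum w c Q ξ)
    {u v : List (Fin (n + 1))} {b b' : Fin n} (hc : c = u ++ h.coxeter.letter b :: v)
    (hb : b' ∈ neighbours b) : h.coxeter.letter b' ∈ u ↔ ξ b' = ξ b + 1 := by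
  have hb2 : b ∈ neighbours b' := mem_neighbours.2 (mem_neighbours.1 hb).symm
  constructor
  · intro hu
    obtain ⟨u1, u2, rfl⟩ := List.append_of_mem hu
    have := h.height_of_append (u := u1) (v := u2 ++ h.coxeter.letter b :: v)
      (i := h.coxeter.letter b') (j := h.coxeter.letter b) (hc.trans (by simp)) (by simp)
      (by rwa [h.coxeter.bar_letter, h.coxeter.bar_letter])
    rwa [h.coxeter.bar_letter, h.coxeter.bar_letter] at this
  · intro hξ
    have hm : h.coxeter.letter b' ∈ u ++ h.coxeter.letter b :: v := hc ▸ h.coxeter.letter_mem b'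
    rw [List.mem_append, List.mem_cons] at hm
    rcases hm with hm | hm | hm
    · exact hm
    · have := h.coxeter.letter_injective hm
      subst this
      omega
    · have := h.height_of_append hc hm (by rwa [h.coxeter.bar_letter, h.coxeter.bar_letter])
      rw [h.coxeter.bar_letter, h.coxeter.bar_letter] at this
      omega

theorem IsTwistedCoxeterWord.exists_eq_append (hc : IsTwistedCoxeterWord c) (b : Fin n) :
    ∃ u v, c = u ++ hc.letter b :: v ∧ hc.letter b ∉ u ∧
      hc.root b = act u (simpleRoot (hc.letter b)) := by
  obtain ⟨u, v, huv, hu⟩ := List.eq_append_cons_of_mem (hc.letter_mem b)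
  refine ⟨u, v, huv, hu, ?_⟩
  have := prefixRoot_append_cons u v _ hu
  rwa [← huv] at this

theorem IsTwistedCoxeterWord.root_mem_posRoots (hn : 2 ≤ n) (hc : IsTwistedCoxeterWord c)
    (b : Fin n) : hc.root b ∈ posRoots n := by
  obtain ⟨u, v, -, hu, h⟩ := hc.exists_eq_append b
  rw [h]
  exact act_simpleRoot_mem_posRoots hn _ _ hu

/-- Apart from α_b, only the neighbouring letters pair with α_b, each to −1. The predicate selects
either the letters before b or all letters but b. -/
theorem IsTwistedCoxeterWord.sum_dotProduct_smul_root (hn : 2 ≤ n) (hc : IsTwistedCoxeterWord c)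
    (b : Fin n) (p : Fin n → Prop) [DecidablePred p] (hp : ¬ p b) :
    (∑ b', if p b' then (simpleRoot (hc.letter b) ⬝ᵥ simpleRoot (hc.letter b')) • hc.root b'
      else 0) = -∑ b' ∈ neighbours b, if p b' then hc.root b' else 0 := by
  rw [← Finset.sum_neg_distrib, ← Finset.sum_subset (Finset.subset_univ (neighbours b))]
  · refine Finset.sum_congr rfl fun b' hb' => ?_
    rw [simpleRoot_dotProduct_simpleRoot hn, hc.bar_letter, hc.bar_letter, if_pos hb']
    by_cases hpb : p b'
    · have hbb : hc.letter b ≠ hc.letter b' := fun e => hp (hc.letter_injective e ▸ hpb)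
      rw [if_pos hpb, if_neg hbb, if_pos hpb, neg_one_smul]
    · rw [if_neg hpb, if_neg hpb, neg_zero]
  · intro b' _ hb'
    rw [simpleRoot_dotProduct_simpleRoot hn, hc.bar_letter, hc.bar_letter, if_neg hb']
    by_cases hpb : p b'
    · have hbb : hc.letter b ≠ hc.letter b' := fun e => hp (hc.letter_injective e ▸ hpb)
      rw [if_pos hpb, if_neg hbb, zero_smul]
    · rw [if_neg hpb]

/-- This is `act_prefix` for x = α_b and the letters before b: among the neighbours of b these are
the ones of larger height. -/
theorem IsCoordinateDatum.simpleRoot_letter (hn : 2 ≤ n) (h : IsCoordinateDatum w c Q ξ)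
    (b : Fin n) : simpleRoot (h.coxeter.letter b) = h.coxeter.root b -
      ∑ b' ∈ neighbours b, if ξ b' = ξ b + 1 then h.coxeter.root b' else 0 := by
  obtain ⟨u, v, huv, hu, hr⟩ := h.coxeter.exists_eq_append b
  have hnd := h.coxeter.nodup
  rw [huv] at hnd
  rw [hr, act_prefix hn u _ hnd, ← huv, h.coxeter.sum_letter u (by rw [huv]; simp)]
  have h1 := h.coxeter.sum_dotProduct_smul_root hn b (fun b' => h.coxeter.letter b' ∈ u) hu
  simp only [IsTwistedCoxeterWord.root] at h1 ⊢
  rw [h1, sub_neg_eq_add, eq_sub_iff_add_eq]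
  congr 1
  refine Finset.sum_congr rfl fun b' hb' => ?_
  simp only [h.letter_mem_iff huv hb']

theorem IsTwistedCoxeterWord.sum_dotProduct_smul_root_univ (hn : 2 ≤ n)
    (hc : IsTwistedCoxeterWord c) (b : Fin n) :
    ∑ b', (simpleRoot (hc.letter b) ⬝ᵥ simpleRoot (hc.letter b')) • hc.root b' =
      (2 : ℤ) • hc.root b - ∑ b' ∈ neighbours b, hc.root b' := by
  have h1 := hc.sum_dotProduct_smul_root hn b (· ≠ b) (by simp)
  have h2 : ∑ b' ∈ neighbours b, (if b' ≠ b then hc.root b' else 0) =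
      ∑ b' ∈ neighbours b, hc.root b' := by
    refine Finset.sum_congr rfl fun b' hb' => if_pos ?_
    rintro rfl
    have := mem_neighbours.1 hb'
    omega
  rw [h2, ← Finset.sum_filter, Finset.filter_ne'] at h1
  rw [← Finset.add_sum_erase _ _ (Finset.mem_univ b), h1, simpleRoot_dotProduct_self hn,
    sub_eq_add_neg]

/-- The vector `±ε_{n+1}` whose pairing with the last letter of a twisted Coxeter word is `1`. -/
theorem IsTwistedCoxeterWord.exists_lastVec (hn : 2 ≤ n) (hc : IsTwistedCoxeterWord c) :
    ∃ e : Fin (n + 1) → ℤ, (e = eps (Fin.last n) ∨ e = -eps (Fin.last n)) ∧ ∀ b : Fin n,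
      e ⬝ᵥ simpleRoot (hc.letter b) = (if b.val + 1 = n then 1 else 0) ∧
      lastNeg (simpleRoot (hc.letter b)) =
        simpleRoot (hc.letter b) - (if b.val + 1 = n then 2 else 0 : ℤ) • e := by
  have hletter : ∀ b : Fin n, min (hc.letter b).val (n - 1) = b.val :=
    fun b => congrArg Fin.val (hc.bar_letter b)
  have hlast := Fin.val_last n
  -- ε_{n+1} pairs to −1 with ε_n − ε_{n+1} and to 1 with ε_n + ε_{n+1}; the sign compensates.
  refine ⟨if (hc.letter ⟨n - 1, by omega⟩).val = n then eps (Fin.last n) else -eps (Fin.last n),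
    by split_ifs <;> simp, fun b => ?_⟩
  by_cases hb : b.val + 1 = n
  · have hbl : (⟨n - 1, by omega⟩ : Fin n) = b := Fin.ext (by simp only; omega)
    rw [hbl, dotProduct_simpleRoot, lastNeg_simpleRoot hn]
    have hb' := hletter b
    generalize hc.letter b = i at *
    have hi := i.isLt
    refine ⟨?_, funext fun a => ?_⟩
    · unfold eps
      split_ifs <;> simp only [Pi.neg_apply, Pi.single_apply, Fin.ext_iff] <;>
        split_ifs <;> omega
    · unfold vee
      simp only [simpleRoot, eps, if_pos hb]
      by_cases h : i.val = n
      · simp only [h, if_true, lt_irrefl, dite_false]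
        rw [dif_pos (by omega)]
        simp only [Pi.sub_apply, Pi.add_apply, Pi.smul_apply, smul_eq_mul, Pi.single_apply,
          Fin.ext_iff, Fin.val_last]
        split_ifs <;> omega
      · rw [if_neg h, if_pos (by omega), dif_neg (by omega), dif_pos (by omega), if_neg h]
        simp only [Pi.sub_apply, Pi.add_apply, Pi.smul_apply, smul_eq_mul, Pi.single_apply,
          Fin.ext_iff, Fin.val_last, Pi.neg_apply]
        split_ifs <;> omega
  · have hb' := hletter b
    have hb2 := b.isLt
    rw [if_neg hb, if_neg hb, zero_smul, sub_zero, lastNeg_simpleRoot hn, dotProduct_simpleRoot]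
    constructor
    · rw [dif_pos (by omega)]
      unfold eps
      split_ifs <;> simp only [Pi.neg_apply, Pi.single_apply, Fin.ext_iff] <;>
        split_ifs <;> omega
    · unfold vee
      rw [if_neg (by omega), if_neg (by omega)]

theorem IsTwistedCoxeterWord.coxeterEquiv_eq (hn : 2 ≤ n) (hc : IsTwistedCoxeterWord c)
    (x : Fin (n + 1) → ℤ) : coxeterEquiv hn c x =
      lastNeg x - ∑ b, (lastNeg x ⬝ᵥ simpleRoot (hc.letter b)) • hc.root b := by
  rw [coxeterEquiv_apply, hc.act_eq hn]

end

/-- The mesh relation is a second-order recursion for `B`. When the height rises, the lower index s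
drops by one; when it falls, s stays and the upper index s + d grows by one. -/
theorem exists_eq_add_of_mesh {M : Type*} [AddCommGroup M] (φ : M ≃+ M) (e : ℤ → M)
    (he : ∀ k, φ (e k) = e (k + 1)) (B : ℕ → M) (h : ℕ → ℤ) (n : ℕ)
    (hh : ∀ d ≤ n, h (d + 1) = h d + 1 ∨ h (d + 1) = h d - 1)
    (hB0 : B 0 = e 0 + e 0) (hB1 : B 1 = e 0 + e 1) (hh1 : h 1 + 1 = h 0)
    (hmesh : ∀ d < n, B (d + 1) + φ (B (d + 1)) =
      (if h d = h (d + 1) + 1 then φ (B d) else B d) +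
        if h (d + 2) = h (d + 1) + 1 then φ (B (d + 2)) else B (d + 2)) :
    ∀ d ≤ n + 1, ∃ s : ℤ, 2 * s + d + h d = h 0 ∧ B d = e s + e (s + d) := by
  have key : ∀ d ≤ n, (∃ s : ℤ, 2 * s + d + h d = h 0 ∧ B d = e s + e (s + d)) ∧
      ∃ s : ℤ, 2 * s + (d + 1 : ℕ) + h (d + 1) = h 0 ∧ B (d + 1) = e s + e (s + (d + 1 : ℕ)) := by
    intro d hd
    induction d with
    | zero => exact ⟨⟨0, by simp, by simpa using hB0⟩, ⟨0, by simpa [add_comm] using hh1,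
        by simpa using hB1⟩⟩
    | succ d ih =>
      obtain ⟨⟨s, hs, hBs⟩, ⟨s', hs', hBs'⟩⟩ := ih (by omega)
      refine ⟨⟨s', hs', hBs'⟩, ?_⟩
      have hm := hmesh d (by omega)
      push_cast at hs' hBs' ⊢
      -- For both orientations the lower neighbour contributes the same two middle terms, so that
      -- the upper neighbour contributes the two outer ones.
      have hlow : (if h d = h (d + 1) + 1 then φ (B d) else B d) =
          e (s' + 1) + e (s' + (d + 1)) := by
        rcases hh d (by omega) with h1 | h1
        · have : s = s' + 1 := by omega
          subst this
          rw [if_neg (by omega), hBs]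
          congr 2
          ring
        · have : s = s' := by omega
          subst this
          rw [if_pos (by omega), hBs, map_add, he, he]
          congr 2
          ring
      rw [hlow, hBs', map_add, he, he] at hm
      have hup : (if h (d + 2) = h (d + 1) + 1 then φ (B (d + 2)) else B (d + 2)) =
          e s' + e (s' + (d + 1) + 1) := by
        rw [← sub_eq_iff_eq_add'] at hm
        rw [← hm]
        abel
      rcases hh (d + 1) hd with h1 | h1
      · rw [if_pos h1] at hup
        refine ⟨s' - 1, by rw [h1]; linarith, φ.injective ?_⟩
        rw [hup, map_add, he, he]
        congr 2 <;> ring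
      · rw [if_neg fun h2 => absurd (h2.symm.trans h1) (by omega)] at hup
        refine ⟨s', by rw [h1]; linarith, ?_⟩
        rw [hup]
        congr 2
        ring
  intro d hd
  rcases Nat.lt_or_ge d (n + 1) with h1 | h1
  · exact (key d (by omega)).1
  · obtain rfl : d = n + 1 := by omega
    exact (key n le_rfl).2

/-! ### Mesh relations and the orbit of ±ε_{n+1} -/

section

variable {n : ℕ} [NeZero n] {w c : List (Fin (n + 1))} {Q : Fin n → Fin n → Prop} {ξ : Fin n → ℤ}

/-- The mesh relations in the first slice, for a vector as in
`IsTwistedCoxeterWord.exists_lastVec`. -/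
theorem IsCoordinateDatum.mesh_aux (hn : 2 ≤ n) (h : IsCoordinateDatum w c Q ξ)
    (e : Fin (n + 1) → ℤ) (he : e = eps (Fin.last n) ∨ e = -eps (Fin.last n))
    (hb : ∀ b : Fin n,
      e ⬝ᵥ simpleRoot (h.coxeter.letter b) = (if b.val + 1 = n then 1 else 0) ∧
      lastNeg (simpleRoot (h.coxeter.letter b)) =
        simpleRoot (h.coxeter.letter b) - (if b.val + 1 = n then 2 else 0 : ℤ) • e) :
    (∀ b : Fin n, b.val + 1 = n → h.coxeter.root b = e + coxeterEquiv hn c e) ∧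
    ∀ b, h.coxeter.root b + coxeterEquiv hn c (h.coxeter.root b) =
      (if b.val + 1 = n then 2 else 0 : ℤ) • coxeterEquiv hn c e +
      ∑ b' ∈ neighbours b, if ξ b' = ξ b + 1 then coxeterEquiv hn c (h.coxeter.root b')
        else h.coxeter.root b' := by
  have hte : lastNeg e = -e := by
    have h1 : lastNeg (eps (Fin.last n)) = -eps (Fin.last n) := by
      funext a
      simp only [lastNeg_apply, eps, Pi.neg_apply, Pi.single_apply, Fin.ext_iff, Fin.val_last]
      split_ifs <;> simp
    rcases he with rfl | rfl
    · exact h1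
    · rw [map_neg, h1]
  have hlast : ∀ b : Fin n, b.val + 1 = n →
      ∑ b', (e ⬝ᵥ simpleRoot (h.coxeter.letter b')) • h.coxeter.root b' = h.coxeter.root b := by
    intro b hbn
    rw [Finset.sum_eq_single b]
    · rw [(hb b).1, if_pos hbn, one_smul]
    · intro b' _ hb'
      rw [(hb b').1, if_neg, zero_smul]
      intro h'
      exact hb' (Fin.ext (by omega))
    · simp
  have h1 : ∀ b : Fin n, b.val + 1 = n → h.coxeter.root b = e + coxeterEquiv hn c e := by
    intro b hbn
    rw [h.coxeter.coxeterEquiv_eq hn, hte]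
    simp only [neg_dotProduct, neg_smul, Finset.sum_neg_distrib]
    rw [hlast b hbn]
    abel
  refine ⟨h1, fun b => ?_⟩
  -- In the last orbit ∨ subtracts 2e from the simple root; since `root b` = e + φ(e) there, the
  -- discrepancy becomes 2φ(e).
  have h2 : coxeterEquiv hn c (simpleRoot (h.coxeter.letter b)) =
      simpleRoot (h.coxeter.letter b) - (2 : ℤ) • h.coxeter.root b +
        ∑ b' ∈ neighbours b, h.coxeter.root b' +
        (if b.val + 1 = n then 2 else 0 : ℤ) • coxeterEquiv hn c e := by
    have h3 : ∑ b', (lastNeg (simpleRoot (h.coxeter.letter b)) ⬝ᵥ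
        simpleRoot (h.coxeter.letter b')) • h.coxeter.root b' =
        (2 : ℤ) • h.coxeter.root b - ∑ b' ∈ neighbours b, h.coxeter.root b' -
        (if b.val + 1 = n then 2 else 0 : ℤ) • h.coxeter.root b := by
      rw [← h.coxeter.sum_dotProduct_smul_root_univ hn]
      by_cases hbn : b.val + 1 = n
      · rw [← hlast b hbn]
        rw [(hb b).2, if_pos hbn, Finset.smul_sum, ← Finset.sum_sub_distrib]
        refine Finset.sum_congr rfl fun b' _ => ?_
        rw [sub_dotProduct, smul_dotProduct, sub_smul, smul_smul, smul_eq_mul]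
      · rw [(hb b).2, if_neg hbn, zero_smul, sub_zero, zero_smul, sub_zero]
    rw [h.coxeter.coxeterEquiv_eq hn, h3, (hb b).2]
    by_cases hbn : b.val + 1 = n
    · rw [h1 b hbn]
      module
    · simp only [if_neg hbn]
      module
  have h4 := h.simpleRoot_letter hn b
  have h5 : ∑ b' ∈ neighbours b, (if ξ b' = ξ b + 1 then coxeterEquiv hn c (h.coxeter.root b')
      else h.coxeter.root b') = coxeterEquiv hn c
        (∑ b' ∈ neighbours b, if ξ b' = ξ b + 1 then h.coxeter.root b' else 0) +
      ∑ b' ∈ neighbours b, h.coxeter.root b' -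
      ∑ b' ∈ neighbours b, if ξ b' = ξ b + 1 then h.coxeter.root b' else 0 := by
    rw [map_sum, ← Finset.sum_add_distrib, ← Finset.sum_sub_distrib]
    refine Finset.sum_congr rfl fun b' _ => ?_
    split_ifs <;> simp
  rw [h5]
  have h6 : h.coxeter.root b = simpleRoot (h.coxeter.letter b) +
      ∑ b' ∈ neighbours b, if ξ b' = ξ b + 1 then h.coxeter.root b' else 0 := by
    rw [h4]
    abel
  nth_rw 2 [h6]
  rw [map_add, h2, h4]
  module

/-- The orbit of `±ε_{n+1}` under the twisted Coxeter element describes the first slice. -/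
theorem IsCoordinateDatum.exists_orbit (hn : 2 ≤ n) (h : IsCoordinateDatum w c Q ξ) :
    ∃ (e : ℤ → Fin (n + 1) → ℤ) (s : Fin n → ℤ) (C : ℤ),
      (e 0 = eps (Fin.last n) ∨ e 0 = -eps (Fin.last n)) ∧
      (∀ k, coxeterEquiv hn c (e k) = e (k + 1)) ∧ (∀ k, e (k + (n + 1)) = -e k) ∧
      (∀ b, 2 * s b + (n - b.val) + ξ b = C) ∧
      ∀ b, h.coxeter.root b = e (s b) + e (s b + (n - b.val)) := by
  obtain ⟨e0, he0, hb⟩ := h.coxeter.exists_lastVec hn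
  obtain ⟨hlast, hmesh⟩ := h.mesh_aux hn e0 he0 hb
  set φ := coxeterEquiv hn c with hφ
  set e : ℤ → Fin (n + 1) → ℤ := fun k => (φ ^ k) e0 with he
  have hee : ∀ k, φ (e k) = e (k + 1) := fun k => by
    simp only [he]
    rw [add_comm k, zpow_add, zpow_one]
    rfl
  have he0' : e 0 = e0 := by simp [he]
  have he1 : e 1 = φ e0 := by simp [he]
  -- Here d = n − b. A fictitious node d = 0 carries 2e_0 and is one higher than the last orbit, so
  -- that the term 2φ(e) is its contribution φ(`B 0`). At the other end a node d = n + 1 carries 0;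
  -- its height only has to differ by one from that of the first orbit.
  set B : ℕ → Fin (n + 1) → ℤ := fun d =>
    if h0 : d = 0 then e 0 + e 0 else if hd : d - 1 < n then h.coxeter.root ⟨n - d, by omega⟩ else 0
    with hB
  set ht : ℕ → ℤ := fun d => if h0 : d = 0 then ξ ⟨n - 1, by omega⟩ + 1 else
    if hd : d - 1 < n then ξ ⟨n - d, by omega⟩ else ξ ⟨0, by omega⟩ + 1 with hht
  have hB0 : B 0 = e 0 + e 0 := by simp [hB]
  have hht0 : ht 0 = ξ ⟨n - 1, by omega⟩ + 1 := by simp [hht]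
  have hBs : ∀ b : Fin n, B (n - b.val) = h.coxeter.root b ∧ ht (n - b.val) = ξ b := by
    intro b
    have hb := b.isLt
    simp only [hB, hht]
    rw [dif_neg (by omega), dif_pos (by omega), dif_neg (by omega), dif_pos (by omega)]
    have : (⟨n - (n - b.val), by omega⟩ : Fin n) = b := Fin.ext (by simp only; omega)
    rw [this]
    exact ⟨rfl, rfl⟩
  have hBn : B (n + 1) = 0 ∧ ht (n + 1) = ξ ⟨0, by omega⟩ + 1 := by
    simp [hB, hht]
  have hBs' : ∀ d (hd : d < n), B (d + 1) = h.coxeter.root ⟨n - (d + 1), by omega⟩ ∧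
      ht (d + 1) = ξ ⟨n - (d + 1), by omega⟩ := fun d hd => by
    have := hBs ⟨n - (d + 1), by omega⟩
    rwa [show n - (⟨n - (d + 1), by omega⟩ : Fin n).val = d + 1 by simp only; omega] at this
  have hB1 := hBs' 0 (by omega)
  have key := exists_eq_add_of_mesh φ.toAddEquiv e hee B ht n ?_ hB0 ?_ ?_ ?_
  · have hs : ∀ b : Fin n, ∃ s : ℤ, 2 * s + (n - b.val) + ξ b = ht 0 ∧
        h.coxeter.root b = e s + e (s + (n - b.val)) := by
      intro b
      have hb := b.isLt
      obtain ⟨s, hs⟩ := key (n - b.val) (by omega)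
      rw [(hBs b).1, (hBs b).2, Nat.cast_sub hb.le] at hs
      exact ⟨s, hs⟩
    choose s hs1 hs2 using hs
    refine ⟨e, s, ht 0, by rwa [he0'], hee, ?_, hs1, hs2⟩
    -- `B (n + 1) = 0` reads e_s + e_{s+n+1} = 0 for one s; powers of φ carry this to every index.
    obtain ⟨s, -, hs⟩ := key (n + 1) le_rfl
    rw [hBn.1] at hs
    intro k
    have h1 : e (s + (n + 1)) = -e s := by
      push_cast at hs
      exact (neg_eq_of_add_eq_zero_right hs.symm).symm
    have h2 : ∀ k m, e (k + m) = (φ ^ k) (e m) := fun k m => by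
      simp only [he]
      rw [zpow_add]
      rfl
    rw [show k + ((n : ℤ) + 1) = (k - s) + (s + (n + 1)) by ring, h2, h1, map_neg, ← h2]
    congr 2
    ring
  · intro d hd
    rcases Nat.eq_zero_or_pos d with rfl | hd0
    · right
      rw [hB1.2, hht0]
      simp
    · obtain ⟨d, rfl⟩ := Nat.exists_eq_add_of_le' hd0
      rw [(hBs' d (by omega)).2]
      rcases Nat.lt_or_ge (d + 1) n with hdn | hdn
      · rw [(hBs' (d + 1) hdn).2]
        refine h.height_neighbour (mem_neighbours.2 (Or.inr ?_))
        simp only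
        omega
      · left
        obtain rfl : n = d + 1 := by omega
        rw [hBn.2]
        simp
  · rw [hB1.1, hlast _ (by simp only; omega), he0', he1]
  · rw [hB1.2, hht0]
  · intro d hd
    have hm := hmesh ⟨n - (d + 1), by omega⟩
    rw [sum_neighbours] at hm
    obtain ⟨hd1, hd2⟩ := hBs' d hd
    rw [hd1, hd2]
    refine hm.trans ?_
    rw [← add_assoc]
    congr 1
    · rcases Nat.eq_zero_or_pos d with rfl | hd0
      · rw [if_pos (by simp only; omega), dif_neg (by simp only; omega), hht0, if_pos (by simp),
          hB0, he0', add_zero, two_smul]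
        exact (map_add φ _ _).symm
      · obtain ⟨d, rfl⟩ := Nat.exists_eq_add_of_le' hd0
        rw [if_neg (by simp only; omega), dif_pos (by simp only; omega), zero_smul, zero_add,
          (hBs' d (by omega)).1, (hBs' d (by omega)).2]
        simp only [show n - (d + 1 + 1) + 1 = n - (d + 1) by omega]
        rfl
    · rcases Nat.lt_or_ge (d + 1) n with hdn | hdn
      · rw [dif_pos (by simp only; omega), (hBs' (d + 1) hdn).1, (hBs' (d + 1) hdn).2]
        simp only [show n - (d + 1) - 1 = n - (d + 1 + 1) by omega]
        rfl
      · obtain rfl : n = d + 1 := by omega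
        rw [dif_neg (by simp), hBn.1]
        simp

end

/-! ### Antiperiodic sequences of signed basis vectors -/

section orbit

variable {M : Type*} [AddCommGroup M] {n : ℕ} {e : ℤ → M}

theorem antiperiodic_add_even_mul (he : ∀ k, e (k + (n + 1)) = -e k) (k q : ℤ) :
    e (k + (n + 1) * (2 * q)) = e k := by
  have h2 : ∀ k, e (k + (n + 1) * 2) = e k := fun k => by
    rw [show k + ((n : ℤ) + 1) * 2 = k + (n + 1) + (n + 1) by ring, he, he, neg_neg]
  induction q using Int.induction_on with
  | zero => simp
  | succ q ih =>
    rw [← ih, ← h2 (k + (n + 1) * (2 * q))]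
    congr 1
    ring
  | pred q ih =>
    rw [← ih, ← h2 (k + (n + 1) * (2 * (-q - 1)))]
    congr 1
    ring

theorem antiperiodic_add_odd_mul (he : ∀ k, e (k + (n + 1)) = -e k) (k q : ℤ) :
    e (k + (n + 1) * (2 * q + 1)) = -e k := by
  rw [← he k, ← antiperiodic_add_even_mul he (k + (n + 1)) q]
  congr 1
  ring

end orbit

/-- Each e_k is ± a basis vector, whose index depends only on k modulo n + 1. All n + 1 coordinates
occur, so distinct residues have distinct indices and give orthogonal vectors. -/
theorem dvd_sub_of_dotProduct_ne_zero {n : ℕ} {e : ℤ → Fin (n + 1) → ℤ}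
    (he : ∀ k, e (k + (n + 1)) = -e k) (h1 : ∀ k, e k ⬝ᵥ e k = 1)
    (hj : ∀ j, ∃ k, e k j ≠ 0) {k l : ℤ} (hkl : e k ⬝ᵥ e l ≠ 0) : ((n : ℤ) + 1) ∣ k - l := by
  choose J hJ using fun k => exists_eps_of_dotProduct_self_eq_one (h1 k)
  have hJ0 : ∀ k a, e k a ≠ 0 → a = J k := by
    intro k a h
    by_contra hne
    rcases hJ k with h' | h' <;> rw [h'] at h <;> simp [eps, hne] at h
  have hJ1 : ∀ k, e k (J k) ≠ 0 := by
    intro k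
    rcases hJ k with h' | h' <;> intro h <;> rw [congrFun h' (J k)] at h <;> simp [eps] at h
  have hmod : ∀ k, J (k % (n + 1)) = J k := by
    intro k
    have hk := Int.emod_add_mul_ediv k (n + 1)
    rcases Int.even_or_odd' (k / (n + 1)) with ⟨q, hq | hq⟩
    · have := antiperiodic_add_even_mul he (k % (n + 1)) q
      rw [← hq, hk] at this
      exact hJ0 _ _ (this ▸ hJ1 _)
    · have := antiperiodic_add_odd_mul he (k % (n + 1)) q
      rw [← hq, hk] at this
      refine hJ0 _ _ ?_
      rw [this]
      simpa using hJ1 _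
  have hN : (0 : ℤ) < n + 1 := by omega
  have hsurj : Function.Surjective fun m : Fin (n + 1) => J m.val := by
    intro j
    obtain ⟨k, hk⟩ := hj j
    have h0 := Int.emod_nonneg k hN.ne'
    have h1 := Int.emod_lt_of_pos k hN
    refine ⟨⟨(k % (n + 1)).toNat, by omega⟩, ?_⟩
    simp only [Int.toNat_of_nonneg h0]
    rw [hmod, ← hJ0 k j hk]
  have hinj := Finite.injective_iff_surjective.2 hsurj
  have hJkl : J k = J l := by
    obtain ⟨a, -, ha⟩ := Finset.exists_ne_zero_of_sum_ne_zero hkl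
    rw [← hJ0 k a (left_ne_zero_of_mul ha), ← hJ0 l a (right_ne_zero_of_mul ha)]
  rw [← hmod k, ← hmod l] at hJkl
  have hk0 := Int.emod_nonneg k hN.ne'
  have hl0 := Int.emod_nonneg l hN.ne'
  have hk1 := Int.emod_lt_of_pos k hN
  have hl1 := Int.emod_lt_of_pos l hN
  have := @hinj ⟨(k % (n + 1)).toNat, by omega⟩ ⟨(l % (n + 1)).toNat, by omega⟩ (by
    simpa only [Int.toNat_of_nonneg hk0, Int.toNat_of_nonneg hl0] using hJkl)
  rw [Fin.mk.injEq] at this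
  exact Int.ModEq.dvd (show l ≡ k [ZMOD n + 1] by
    unfold Int.ModEq
    omega)

theorem dvd_sub_of_dotProduct_eq_one {n : ℕ} {e : ℤ → Fin (n + 1) → ℤ}
    (he : ∀ k, e (k + (n + 1)) = -e k) (h1 : ∀ k, e k ⬝ᵥ e k = 1)
    (hj : ∀ j, ∃ k, e k j ≠ 0) {k l : ℤ} (hkl : e k ⬝ᵥ e l = 1) :
    (2 * ((n : ℤ) + 1)) ∣ k - l := by
  obtain ⟨q, hq⟩ := dvd_sub_of_dotProduct_ne_zero he h1 hj (hkl.trans_ne one_ne_zero)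
  obtain rfl : k = l + (n + 1) * q := by omega
  rcases Int.even_or_odd' q with ⟨q, rfl | rfl⟩
  · exact ⟨q, by ring⟩
  · rw [antiperiodic_add_odd_mul he, neg_dotProduct, h1] at hkl
    omega

/-- A root is the sum of two vectors of the orbit in only one way. -/
theorem add_orbit_injective {n : ℕ} {e : ℤ → Fin (n + 1) → ℤ}
    (he : ∀ k, e (k + (n + 1)) = -e k) (h1 : ∀ k, e k ⬝ᵥ e k = 1)
    (hj : ∀ j, ∃ k, e k j ≠ 0) {s s' d d' : ℤ} (hd : 0 < d) (hdn : d ≤ n) (hd' : 0 < d')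
    (hdn' : d' ≤ n) (h : e s + e (s + d) = e s' + e (s' + d')) :
    d = d' ∧ (2 * ((n : ℤ) + 1)) ∣ s - s' := by
  have hle : ∀ k l, e k ⬝ᵥ e l ≤ 1 := fun k l => by
    have h0 : 0 ≤ (e k - e l) ⬝ᵥ (e k - e l) := Finset.sum_nonneg fun a _ => mul_self_nonneg _
    simp only [dotProduct_sub, sub_dotProduct, h1, dotProduct_comm (e l) (e k)] at h0
    omega
  have h0 : e s ⬝ᵥ e (s + d) = 0 := by
    by_contra h0
    have h2 := dvd_sub_of_dotProduct_ne_zero he h1 hj h0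
    rw [sub_add_cancel_left, dvd_neg] at h2
    have := Int.le_of_dvd hd h2
    omega
  -- Integers at most 1 with sum 1 cannot both be different from 1.
  have hmem : ∀ k, e k ⬝ᵥ (e s + e (s + d)) = 1 →
      (2 * ((n : ℤ) + 1)) ∣ k - s' ∨ (2 * ((n : ℤ) + 1)) ∣ k - (s' + d') := by
    intro k hk
    rw [h, dotProduct_add] at hk
    have h2 := hle k s'
    have h3 := hle k (s' + d')
    by_cases h4 : e k ⬝ᵥ e s' = 1
    · exact Or.inl (dvd_sub_of_dotProduct_eq_one he h1 hj h4)
    · exact Or.inr (dvd_sub_of_dotProduct_eq_one he h1 hj (by omega))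
  have hs := hmem s (by rw [dotProduct_add, h1, h0, add_zero])
  have hsd := hmem (s + d) (by rw [dotProduct_add, h1, dotProduct_comm, h0, zero_add])
  have hsmall : ∀ x : ℤ, 0 < x → x < 2 * ((n : ℤ) + 1) → ¬ (2 * ((n : ℤ) + 1)) ∣ x :=
    fun x hx hx' hdvd => by
      have := Int.le_of_dvd hx hdvd
      omega
  -- Matching both indices with the same one would make d divisible by 2(n+1), the crossed matching
  -- would do so for d + d' ≤ 2n; the direct matching remains.
  rcases hs with hs | hs <;> rcases hsd with hsd | hsd
  · refine absurd ?_ (hsmall d hd (by omega))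
    have := dvd_sub hsd hs
    rwa [show s + d - s' - (s - s') = d by ring] at this
  · have h2 := dvd_sub hsd hs
    rw [show s + d - (s' + d') - (s - s') = d - d' by ring] at h2
    have := Int.eq_zero_of_abs_lt_dvd h2 (by rw [abs_lt]; omega)
    exact ⟨by omega, hs⟩
  · refine absurd ?_ (hsmall (d + d') (by omega) (by omega))
    have := dvd_sub hsd hs
    rwa [show s + d - s' - (s - (s' + d')) = d + d' by ring] at this
  · refine absurd ?_ (hsmall d hd (by omega))
    have := dvd_sub hsd hs
    rwa [show s + d - (s' + d') - (s - (s' + d')) = d by ring] at this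

/-! ### The slices φ^k(`root b`) -/

section

variable {n : ℕ} [NeZero n] {w c : List (Fin (n + 1))} {Q : Fin n → Fin n → Prop} {ξ : Fin n → ℤ}

theorem coxeterEquiv_dotProduct {n : ℕ} (hn : 2 ≤ n) (c : List (Fin (n + 1)))
    (v x : Fin (n + 1) → ℤ) : coxeterEquiv hn c v ⬝ᵥ coxeterEquiv hn c x = v ⬝ᵥ x := by
  rw [coxeterEquiv_apply, coxeterEquiv_apply, act_dotProduct_act hn, lastNeg_dotProduct,
    lastNeg_lastNeg]

/-- The image of a root of the first slice under a power of the twisted Coxeter element. -/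
noncomputable def IsTwistedCoxeterWord.sliceRoot (hn : 2 ≤ n) (hc : IsTwistedCoxeterWord c)
    (b : Fin n) (k : ℕ) : Fin (n + 1) → ℤ := (coxeterEquiv hn c)^[k] (hc.root b)

theorem IsTwistedCoxeterWord.sliceRoot_zero (hn : 2 ≤ n) (hc : IsTwistedCoxeterWord c)
    (b : Fin n) : hc.sliceRoot hn b 0 = hc.root b := rfl

theorem IsTwistedCoxeterWord.sliceRoot_succ (hn : 2 ≤ n) (hc : IsTwistedCoxeterWord c)
    (b : Fin n) (k : ℕ) :
    hc.sliceRoot hn b (k + 1) = coxeterEquiv hn c (hc.sliceRoot hn b k) :=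
  Function.iterate_succ_apply' _ _ _

theorem IsTwistedCoxeterWord.sliceRoot_dotProduct_self (hn : 2 ≤ n)
    (hc : IsTwistedCoxeterWord c) (b : Fin n) (k : ℕ) :
    hc.sliceRoot hn b k ⬝ᵥ hc.sliceRoot hn b k = 2 := by
  induction k with
  | zero => exact dotProduct_self_of_mem_posRoots (hc.root_mem_posRoots hn b)
  | succ k ih => rw [hc.sliceRoot_succ, coxeterEquiv_dotProduct, ih]

/-- The simple root of the letter in orbit j has a nonzero j-th entry and is a combination of
first-slice roots. Hence the sequence e_k reaches every coordinate but the last, which e_0 supplies.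
-/
theorem IsCoordinateDatum.exists_apply_ne_zero (hn : 2 ≤ n) (h : IsCoordinateDatum w c Q ξ)
    {j : Fin (n + 1)} (hj : j ≠ Fin.last n) : ∃ b, h.coxeter.root b j ≠ 0 := by
  by_contra! h0
  have h1 : ∀ b, simpleRoot (h.coxeter.letter b) j = 0 := by
    intro b
    rw [h.simpleRoot_letter hn b, Pi.sub_apply, h0, Finset.sum_apply, zero_sub, neg_eq_zero]
    refine Finset.sum_eq_zero fun b' _ => ?_
    split_ifs
    · exact h0 b'
    · rfl
  have hjn : j.val < n := Fin.val_lt_last hj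
  have h2 := h1 ⟨j.val, hjn⟩
  have h3 : min (h.coxeter.letter ⟨j.val, hjn⟩).val (n - 1) = j.val :=
    congrArg Fin.val (h.coxeter.bar_letter ⟨j.val, hjn⟩)
  generalize h.coxeter.letter ⟨j.val, hjn⟩ = i at h2 h3
  simp only [simpleRoot, eps] at h2
  split_ifs at h2 <;>
    simp only [Pi.sub_apply, Pi.add_apply, Pi.single_apply, Fin.ext_iff, Fin.val_last] at h2 <;>
    split_ifs at h2 <;> omega

/-- All the roots in the slices are sums of two vectors of an antiperiodic sequence, and this
description is unique. -/
theorem IsCoordinateDatum.exists_sliceRoot_eq (hn : 2 ≤ n) (h : IsCoordinateDatum w c Q ξ) :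
    ∃ (e : ℤ → Fin (n + 1) → ℤ) (s : Fin n → ℤ) (C : ℤ),
      (∀ k, e (k + (n + 1)) = -e k) ∧ (∀ b, 2 * s b + (n - b.val) + ξ b = C) ∧
      (∀ b (k : ℕ), h.coxeter.sliceRoot hn b k = e (s b + k) + e (s b + k + (n - b.val))) ∧
      ∀ {s s' d d' : ℤ}, 0 < d → d ≤ n → 0 < d' → d' ≤ n →
        e s + e (s + d) = e s' + e (s' + d') → d = d' ∧ (2 * ((n : ℤ) + 1)) ∣ s - s' := by
  obtain ⟨e, s, C, he0, hφ, he, hs, hr⟩ := h.exists_orbit hn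
  have hr' : ∀ b (k : ℕ),
      h.coxeter.sliceRoot hn b k = e (s b + k) + e (s b + k + (n - b.val)) := by
    intro b k
    induction k with
    | zero =>
      rw [h.coxeter.sliceRoot_zero]
      simpa using hr b
    | succ k ih =>
      rw [h.coxeter.sliceRoot_succ, ih, map_add, hφ, hφ]
      push_cast
      congr 2 <;> ring
  refine ⟨e, s, C, he, hs, hr', ?_⟩
  have h1 : ∀ k, e k ⬝ᵥ e k = 1 := by
    have hsucc : ∀ k, e (k + 1) ⬝ᵥ e (k + 1) = e k ⬝ᵥ e k := fun k => by
      rw [← hφ, coxeterEquiv_dotProduct]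
    intro k
    induction k using Int.induction_on with
    | zero => rcases he0 with h | h <;> rw [h] <;> simp [eps]
    | succ k ih => rw [hsucc, ih]
    | pred k ih => rw [← hsucc, sub_add_cancel, ih]
  have hj : ∀ j, ∃ k, e k j ≠ 0 := by
    intro j
    by_cases hjl : j = Fin.last n
    · refine ⟨0, ?_⟩
      rcases he0 with h | h <;> rw [h, hjl] <;> simp [eps]
    · obtain ⟨b, hb⟩ := h.exists_apply_ne_zero hn hjl
      by_contra! h0
      rw [hr, Pi.add_apply, h0, h0] at hb
      exact hb rfl
  intro s s' d d' hd hdn hd' hdn' hs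
  exact add_orbit_injective he h1 hj hd hdn hd' hdn' hs

theorem IsCoordinateDatum.sliceRoot_add (hn : 2 ≤ n) (h : IsCoordinateDatum w c Q ξ)
    (b : Fin n) (k : ℕ) :
    h.coxeter.sliceRoot hn b (k + (n + 1)) = -h.coxeter.sliceRoot hn b k := by
  obtain ⟨e, s, C, he, hs, hr, -⟩ := h.exists_sliceRoot_eq hn
  rw [hr, hr, neg_add, ← he, ← he]
  push_cast
  congr 2 <;> ring

theorem IsCoordinateDatum.sliceRoot_injective (hn : 2 ≤ n) (h : IsCoordinateDatum w c Q ξ)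
    {b b' : Fin n} {k k' : ℕ} (hk : k < 2 * (n + 1)) (hk' : k' < 2 * (n + 1))
    (hbk : h.coxeter.sliceRoot hn b k = h.coxeter.sliceRoot hn b' k') : b = b' ∧ k = k' := by
  obtain ⟨e, s, C, he, hs, hr, hinj⟩ := h.exists_sliceRoot_eq hn
  have hb := b.isLt
  have hb' := b'.isLt
  rw [hr, hr] at hbk
  obtain ⟨h1, h2⟩ := hinj (by omega) (by omega) (by omega) (by omega) hbk
  obtain rfl : b = b' := Fin.ext (by omega)
  rw [add_sub_add_left_eq_sub] at h2
  have := Int.eq_zero_of_abs_lt_dvd h2 (by rw [abs_lt]; omega)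
  exact ⟨rfl, by omega⟩

/-- If φ first makes the root negative at step k, its negative is an inversion of `c`, that is, some
`root b'`. So the root is −`root b'` = φ^{n+1}(`root b'`), and uniqueness forces k = n + 1. -/
theorem IsCoordinateDatum.sliceRoot_mem_posRoots (hn : 2 ≤ n) (h : IsCoordinateDatum w c Q ξ)
    (b : Fin n) {k : ℕ} (hk : k ≤ n) : h.coxeter.sliceRoot hn b k ∈ posRoots n := by
  induction k with
  | zero => exact h.coxeter.root_mem_posRoots hn b
  | succ k ih =>
    refine (mem_posRoots_or_neg_mem (h.coxeter.sliceRoot_dotProduct_self hn b _)).resolve_right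
      fun hneg => ?_
    have hpos := mem_posRoots_iff.1 (ih (by omega))
    have hx : -(-lastNeg (h.coxeter.sliceRoot hn b k)) ∈ posRoots n := by
      rw [neg_neg, mem_posRoots_iff, lastNeg_dotProduct, lastNeg_lastNeg, rootHeight_lastNeg]
      exact hpos
    have hact : act c (-lastNeg (h.coxeter.sliceRoot hn b k)) =
        -h.coxeter.sliceRoot hn b (k + 1) := by
      rw [h.coxeter.sliceRoot_succ, ← map_neg, ← map_neg, coxeterEquiv_apply]
    obtain ⟨u, i, v, huv, hu⟩ := exists_act_eq_of_neg hn c hx (hact ▸ hneg)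
    have hnd := h.coxeter.nodup
    rw [huv] at hnd
    have hiu : i ∉ u := fun hi => List.disjoint_of_nodup_append hnd hi (by simp)
    have hic : i ∈ c := by
      rw [huv]
      simp
    have hroot : h.coxeter.root (bar i) = act u (simpleRoot i) := by
      rw [IsTwistedCoxeterWord.root, h.coxeter.letter_bar hic, ← prefixRoot_append_cons u v i hiu,
        ← huv]
    rw [hact, ← hroot, ← h.coxeter.sliceRoot_zero hn, neg_eq_iff_eq_neg, ← h.sliceRoot_add] at hu
    have := (h.sliceRoot_injective hn (by omega) (by omega) hu).2
    omega

/-! Coordinates. -/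

theorem act_append_map_vee {n : ℕ} (hn : 2 ≤ n) (c u : List (Fin (n + 1)))
    (v : Fin (n + 1) → ℤ) :
    act (c ++ u.map vee) v = coxeterEquiv hn c (act u (lastNeg v)) := by
  rw [act_append, act_map_vee hn, coxeterEquiv_apply]

/-- The two initial clauses are k = 0 and k = 1, and ψ = φ² adds 2 to k. Positivity stops this at n,
since φ^{n+1} negates the slices. -/
theorem IsCoordinateDatum.hasCoord_iff (hn : 2 ≤ n) (h : IsCoordinateDatum w c Q ξ)
    {γ : Fin (n + 1) → ℤ} {i : Fin (n + 1)} {p : ℤ} : HasCoord c ξ γ i p ↔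
      ∃ (b : Fin n) (k : ℕ), k ≤ n ∧ γ = h.coxeter.sliceRoot hn b k ∧
        i = vee^[k] (h.coxeter.letter b) ∧ p = ξ b - 2 * k := by
  have hroot : ∀ u v i, c = u ++ i :: v → i = h.coxeter.letter (bar i) ∧
      act u (simpleRoot i) = h.coxeter.root (bar i) := by
    intro u v i huv
    have hnd := h.coxeter.nodup
    rw [huv] at hnd
    have hiu : i ∉ u := fun hi => List.disjoint_of_nodup_append hnd hi (by simp)
    have hic : i ∈ c := by
      rw [huv]
      simp
    refine ⟨(h.coxeter.letter_bar hic).symm, ?_⟩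
    rw [IsTwistedCoxeterWord.root, h.coxeter.letter_bar hic, ← prefixRoot_append_cons u v i hiu,
      ← huv]
  have hstep : ∀ b k, act (c ++ c.map vee) (h.coxeter.sliceRoot hn b k) =
      h.coxeter.sliceRoot hn b (k + 2) := by
    intro b k
    rw [act_append_map_vee hn, ← coxeterEquiv_apply hn, ← h.coxeter.sliceRoot_succ,
      ← h.coxeter.sliceRoot_succ]
  constructor
  · intro hγ
    induction hγ with
    | first u v i hc =>
      obtain ⟨h1, h2⟩ := hroot u v i hc
      exact ⟨bar i, 0, by omega, h2, h1, by simp⟩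
    | second u v i hc =>
      obtain ⟨h1, h2⟩ := hroot u v i hc
      refine ⟨bar i, 1, by omega, ?_, congrArg vee h1, by simp⟩
      rw [act_append_map_vee hn, ← lastNeg_simpleRoot hn, lastNeg_lastNeg, h2]
      rfl
    | step β i p hβ hψβ _ ih =>
      obtain ⟨b, k, hk, rfl, rfl, rfl⟩ := ih
      rw [hstep] at hψβ ⊢
      refine ⟨b, k + 2, ?_, rfl, (iterate_vee_add_two k _).symm, by push_cast; ring⟩
      by_contra hk2
      have h1 := rootHeight_pos hψβ
      rw [show k + 2 = (k + 1 - n) + (n + 1) by omega, h.sliceRoot_add, rootHeight_neg] at h1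
      have h2 := rootHeight_pos (h.sliceRoot_mem_posRoots hn b (k := k + 1 - n) (by omega))
      omega
  · rintro ⟨b, k, hk, rfl, rfl, rfl⟩
    obtain ⟨u, v, huv, hu, hr⟩ := h.coxeter.exists_eq_append b
    induction k using Nat.twoStepInduction with
    | zero =>
      have := HasCoord.first (ξ := ξ) u v _ huv
      rw [← hr, h.coxeter.bar_letter] at this
      rw [h.coxeter.sliceRoot_zero]
      simpa using this
    | one =>
      have := HasCoord.second (ξ := ξ) u v _ huv
      rw [act_append_map_vee hn, ← lastNeg_simpleRoot hn, lastNeg_lastNeg, ← hr,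
        h.coxeter.bar_letter] at this
      rw [h.coxeter.sliceRoot_succ, h.coxeter.sliceRoot_zero]
      simpa using this
    | more k ih _ =>
      have := HasCoord.step _ _ _ (h.sliceRoot_mem_posRoots hn b (by omega))
        (by rw [hstep]; exact h.sliceRoot_mem_posRoots hn b hk) (ih (by omega))
      rw [hstep] at this
      rw [iterate_vee_add_two]
      convert this using 1
      push_cast
      ring

theorem IsCoordinateDatum.hasFoldedCoord_iff (hn : 2 ≤ n) (h : IsCoordinateDatum w c Q ξ)
    {γ : Fin (n + 1) → ℤ} {b : Fin n} {p : ℤ} : HasFoldedCoord c ξ γ b p ↔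
      ∃ k : ℕ, k ≤ n ∧ γ = h.coxeter.sliceRoot hn b k ∧ p = ξ b - 2 * k := by
  constructor
  · rintro ⟨i, rfl, hi⟩
    obtain ⟨b, k, hk, hγ, rfl, hp⟩ := (h.hasCoord_iff hn).1 hi
    rw [bar_iterate_vee, h.coxeter.bar_letter]
    exact ⟨k, hk, hγ, hp⟩
  · rintro ⟨k, hk, hγ, hp⟩
    refine ⟨vee^[k] (h.coxeter.letter b), ?_, (h.hasCoord_iff hn).2 ⟨b, k, hk, hγ, rfl, hp⟩⟩
    rw [bar_iterate_vee, h.coxeter.bar_letter]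

theorem IsCoordinateDatum.hasFoldedCoord_sliceRoot (hn : 2 ≤ n) (h : IsCoordinateDatum w c Q ξ)
    (b : Fin n) {k : ℕ} (hk : k ≤ n) {p : ℤ} (hp : p = ξ b - 2 * k) :
    HasFoldedCoord c ξ (h.coxeter.sliceRoot hn b k) b p :=
  (h.hasFoldedCoord_iff hn).2 ⟨k, hk, rfl, hp⟩

theorem IsCoordinateDatum.mem_posRoots_of_hasFoldedCoord (hn : 2 ≤ n)
    (h : IsCoordinateDatum w c Q ξ) {γ : Fin (n + 1) → ℤ} {b : Fin n} {p : ℤ}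
    (hγ : HasFoldedCoord c ξ γ b p) : γ ∈ posRoots n := by
  obtain ⟨k, hk, rfl, -⟩ := (h.hasFoldedCoord_iff hn).1 hγ
  exact h.sliceRoot_mem_posRoots hn b hk

theorem IsCoordinateDatum.hasFoldedCoord_unique (hn : 2 ≤ n) (h : IsCoordinateDatum w c Q ξ)
    {γ : Fin (n + 1) → ℤ} {b b' : Fin n} {p p' : ℤ} (hγ : HasFoldedCoord c ξ γ b p)
    (hγ' : HasFoldedCoord c ξ γ b' p') : b = b' ∧ p = p' := by
  obtain ⟨k, hk, rfl, rfl⟩ := (h.hasFoldedCoord_iff hn).1 hγ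
  obtain ⟨k', hk', hkk, rfl⟩ := (h.hasFoldedCoord_iff hn).1 hγ'
  obtain ⟨rfl, rfl⟩ := h.sliceRoot_injective hn (by omega) (by omega) hkk
  exact ⟨rfl, rfl⟩

theorem IsCoordinateDatum.eq_of_hasFoldedCoord (hn : 2 ≤ n) (h : IsCoordinateDatum w c Q ξ)
    {γ δ : Fin (n + 1) → ℤ} {b : Fin n} {p : ℤ} (hγ : HasFoldedCoord c ξ γ b p)
    (hδ : HasFoldedCoord c ξ δ b p) : γ = δ := by
  obtain ⟨k, hk, rfl, rfl⟩ := (h.hasFoldedCoord_iff hn).1 hγ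
  obtain ⟨k', hk', rfl, hkk⟩ := (h.hasFoldedCoord_iff hn).1 hδ
  obtain rfl : k = k' := by omega
  rfl

/-! ### Arrows and paths of the folded AR-quiver -/

theorem IsCoordinateDatum.arrow_iff (hn : 2 ≤ n) (h : IsCoordinateDatum w c Q ξ)
    {γ δ : Fin (n + 1) → ℤ} : Arrow c ξ γ δ ↔ ∃ b b' p, HasFoldedCoord c ξ γ b p ∧
      HasFoldedCoord c ξ δ b' (p + 1) ∧ b' ∈ neighbours b := by
  constructor
  · rintro ⟨-, -, i, j, p, hi, hj, hij⟩
    exact ⟨bar i, bar j, p, ⟨i, rfl, hi⟩, ⟨j, rfl, hj⟩,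
      mem_neighbours.2 ((dynkinAdj_iff hn _ _).1 hij)⟩
  · rintro ⟨b, b', p, hγ, hδ, hb⟩
    refine ⟨h.mem_posRoots_of_hasFoldedCoord hn hγ, h.mem_posRoots_of_hasFoldedCoord hn hδ, ?_⟩
    obtain ⟨i, rfl, hi⟩ := hγ
    obtain ⟨j, rfl, hj⟩ := hδ
    exact ⟨i, j, p, hi, hj, (dynkinAdj_iff hn _ _).2 (mem_neighbours.1 hb)⟩

theorem IsCoordinateDatum.le_of_path (hn : 2 ≤ n) (h : IsCoordinateDatum w c Q ξ)
    {γ δ : Fin (n + 1) → ℤ} (hp : Relation.ReflTransGen (Arrow c ξ) γ δ) {b b' : Fin n}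
    {p p' : ℤ} (hγ : HasFoldedCoord c ξ γ b p) (hδ : HasFoldedCoord c ξ δ b' p') :
    p ≤ p' ∧ (p = p' → b = b') := by
  induction hp using Relation.ReflTransGen.head_induction_on generalizing b p with
  | refl =>
    obtain ⟨h1, h2⟩ := h.hasFoldedCoord_unique hn hγ hδ
    exact ⟨h2.le, fun _ => h1⟩
  | head hx _ ih =>
    obtain ⟨a, a', q, ha, ha', -⟩ := (h.arrow_iff hn).1 hx
    obtain ⟨rfl, rfl⟩ := h.hasFoldedCoord_unique hn hγ ha
    have := (ih ha').1
    exact ⟨by omega, fun _ => by omega⟩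

theorem IsCoordinateDatum.exists_neighbour_of_path (hn : 2 ≤ n) (h : IsCoordinateDatum w c Q ξ)
    {γ δ : Fin (n + 1) → ℤ} (hp : Relation.ReflTransGen (Arrow c ξ) γ δ) {b b' : Fin n}
    {p p' : ℤ} (hγ : HasFoldedCoord c ξ γ b p) (hδ : HasFoldedCoord c ξ δ b' p')
    (hlt : p < p') : ∃ a ε, a ∈ neighbours b ∧ HasFoldedCoord c ξ ε a (p + 1) ∧
      Relation.ReflTransGen (Arrow c ξ) ε δ := by
  rcases hp.cases_head with rfl | ⟨ε, hε, hεδ⟩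
  · have := (h.hasFoldedCoord_unique hn hγ hδ).2
    omega
  · obtain ⟨a, a', q, ha, ha', haa⟩ := (h.arrow_iff hn).1 hε
    obtain ⟨rfl, rfl⟩ := h.hasFoldedCoord_unique hn hγ ha
    exact ⟨a', ε, haa, ha', hεδ⟩

/-! ### The additive property for the two orbit sizes -/

theorem orbitSize_eq (hn : 2 ≤ n) (b : Fin n) :
    orbitSize b = if b.val + 1 = n then 2 else 1 := by
  have hb := b.isLt
  unfold orbitSize
  split_ifs with h
  · have : (Finset.univ.filter fun i : Fin (n + 1) => bar i = b) =
        {b.castSucc, Fin.last n} := by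
      ext i
      have := i.isLt
      simp only [bar, Finset.mem_filter, Finset.mem_univ, true_and, Finset.mem_insert,
        Finset.mem_singleton, Fin.ext_iff, Fin.val_castSucc, Fin.val_last]
      omega
    rw [this, Finset.card_pair]
    simp only [ne_eq, Fin.ext_iff, Fin.val_castSucc, Fin.val_last]
    omega
  · have : (Finset.univ.filter fun i : Fin (n + 1) => bar i = b) = {b.castSucc} := by
      ext i
      have := i.isLt
      simp only [bar, Finset.mem_filter, Finset.mem_univ, true_and,
        Finset.mem_singleton, Fin.ext_iff, Fin.val_castSucc]
      omega
    rw [this, Finset.card_singleton]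

theorem IsCoordinateDatum.mesh (hn : 2 ≤ n) (h : IsCoordinateDatum w c Q ξ) {b : Fin n}
    (hb : b.val + 1 ≠ n) (k : ℕ) :
    h.coxeter.sliceRoot hn b (k + 1) + h.coxeter.sliceRoot hn b k = ∑ b' ∈ neighbours b,
      h.coxeter.sliceRoot hn b' (if ξ b' = ξ b + 1 then k + 1 else k) := by
  induction k with
  | zero =>
    obtain ⟨e, he, hbe⟩ := h.coxeter.exists_lastVec hn
    have := (h.mesh_aux hn e he hbe).2 b
    rw [if_neg hb, zero_smul, zero_add] at this
    refine (add_comm _ _).trans (this.trans <| Finset.sum_congr rfl fun b' _ => ?_)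
    split_ifs <;> rfl
  | succ k ih =>
    rw [h.coxeter.sliceRoot_succ hn b (k + 1)]
    nth_rw 2 [h.coxeter.sliceRoot_succ hn b k]
    rw [← map_add, ih, map_sum]
    refine Finset.sum_congr rfl fun b' _ => ?_
    split_ifs <;> exact (h.coxeter.sliceRoot_succ hn b' _).symm

theorem IsCoordinateDatum.add_eq_sum_of_short (hn : 2 ≤ n) (h : IsCoordinateDatum w c Q ξ)
    {α β : Fin (n + 1) → ℤ} {b : Fin n} (hb : b.val + 1 ≠ n) {p : ℤ}
    (hα : HasFoldedCoord c ξ α b (p - 2)) (hβ : HasFoldedCoord c ξ β b p) :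
    α + β = ∑ γ ∈ betweenAt c ξ α β (p - 1), γ := by
  classical
  obtain ⟨k, hk, hβk, hp⟩ := (h.hasFoldedCoord_iff hn).1 hβ
  obtain ⟨k', hk', hαk, hp'⟩ := (h.hasFoldedCoord_iff hn).1 hα
  obtain rfl : k' = k + 1 := by omega
  set g : Fin n → Fin (n + 1) → ℤ :=
    fun b' => h.coxeter.sliceRoot hn b' (if ξ b' = ξ b + 1 then k + 1 else k) with hg
  have hgc : ∀ b' ∈ neighbours b, HasFoldedCoord c ξ (g b') b' (p - 1) := by
    intro b' hb'
    have := h.height_neighbour hb'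
    -- Both exponents are at most k + 1, which is at most n because α is a vertex.
    refine h.hasFoldedCoord_sliceRoot hn b' ?_ ?_ <;> split_ifs <;> push_cast <;> omega
  have hJ : betweenAt c ξ α β (p - 1) = (neighbours b).image g := by
    ext γ
    simp only [betweenAt, Finset.mem_filter, Finset.mem_image]
    constructor
    · rintro ⟨-, ⟨hαγ, -⟩, j, hj⟩
      obtain ⟨a, ε, ha, hε, hεγ⟩ := h.exists_neighbour_of_path hn hαγ hα hj (by omega)
      obtain rfl := (h.le_of_path hn hεγ hε hj).2 (by ring)
      exact ⟨a, ha, h.eq_of_hasFoldedCoord hn (hgc a ha) hj⟩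
    · rintro ⟨b', hb', rfl⟩
      have hc := hgc b' hb'
      refine ⟨h.mem_posRoots_of_hasFoldedCoord hn hc, ⟨.single ?_, .single ?_⟩, b', hc⟩
      · exact (h.arrow_iff hn).2 ⟨b, b', p - 2, hα, by convert hc using 1; ring, hb'⟩
      · exact (h.arrow_iff hn).2 ⟨b', b, p - 1, hc, by convert hβ using 1; ring,
          mem_neighbours.2 (mem_neighbours.1 hb').symm⟩
  rw [hJ, Finset.sum_image, hαk, hβk, h.mesh hn hb]
  intro x hx y hy hxy
  exact (h.hasFoldedCoord_unique hn (hgc x hx) (hxy ▸ hgc y hy)).1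

/-- The last orbit has a single neighbour a, so a path of length 2 from α ends over a neighbour of
a. The identity is e_m + e_{m+1} + e_{m+2} + e_{m+3} grouped into outer and inner pairs. -/
theorem IsCoordinateDatum.add_eq_sum_of_long (hn : 2 ≤ n) (h : IsCoordinateDatum w c Q ξ)
    {α β : Fin (n + 1) → ℤ} {b : Fin n} (hb : b.val + 1 = n) {p : ℤ}
    (hα : HasFoldedCoord c ξ α b (p - 4)) (hβ : HasFoldedCoord c ξ β b p) :
    α + β = ∑ γ ∈ betweenAt c ξ α β (p - 2), γ := by
  classical
  obtain ⟨k, hk, hβk, hp⟩ := (h.hasFoldedCoord_iff hn).1 hβ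
  obtain ⟨k', hk', hαk, hp'⟩ := (h.hasFoldedCoord_iff hn).1 hα
  obtain rfl : k' = k + 2 := by omega
  set a : Fin n := ⟨n - 2, by omega⟩ with ha
  have hba : b ∈ neighbours a := mem_neighbours.2 (Or.inl (by simp only [ha]; omega))
  have hab : a ∈ neighbours b := mem_neighbours.2 (mem_neighbours.1 hba).symm
  have hab' : ∀ a' ∈ neighbours b, a' = a := by
    intro a' ha'
    have := a'.isLt
    rw [mem_neighbours] at ha'
    refine Fin.ext ?_
    simp only [ha]
    omega
  have hξa := h.height_neighbour hba
  have hg : ∀ b' ∈ neighbours a, ∃ m : ℕ, m ≤ n ∧ p - 2 = ξ b' - 2 * m := by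
    intro b' hb'
    have := h.height_neighbour hb'
    -- The heights of b and b' differ by 0 or ±2, so the exponent lies between k and k + 2, the
    -- exponents of β and α.
    exact ⟨((ξ b' - p + 2) / 2).toNat, by omega, by omega⟩
  choose! m hmn hm using hg
  have hgc : ∀ b' ∈ neighbours a,
      HasFoldedCoord c ξ (h.coxeter.sliceRoot hn b' (m b')) b' (p - 2) :=
    fun b' hb' => h.hasFoldedCoord_sliceRoot hn b' (hmn b' hb') (hm b' hb')
  obtain ⟨x, hx⟩ : ∃ x, HasFoldedCoord c ξ x a (p - 3) :=
    ⟨_, h.hasFoldedCoord_sliceRoot hn a (k := ((ξ a - p + 3) / 2).toNat) (by omega) (by omega)⟩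
  obtain ⟨y, hy⟩ : ∃ y, HasFoldedCoord c ξ y a (p - 1) :=
    ⟨_, h.hasFoldedCoord_sliceRoot hn a (k := ((ξ a - p + 1) / 2).toNat) (by omega) (by omega)⟩
  have hJ : betweenAt c ξ α β (p - 2) =
      (neighbours a).image fun b' => h.coxeter.sliceRoot hn b' (m b') := by
    ext γ
    simp only [betweenAt, Finset.mem_filter, Finset.mem_image]
    constructor
    · rintro ⟨-, ⟨hαγ, -⟩, j, hj⟩
      obtain ⟨a1, ε, ha1, hε, hεγ⟩ := h.exists_neighbour_of_path hn hαγ hα hj (by omega)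
      obtain rfl := hab' a1 ha1
      obtain ⟨a2, ε', ha2, hε', hεγ'⟩ := h.exists_neighbour_of_path hn hεγ hε hj (by omega)
      obtain rfl := (h.le_of_path hn hεγ' hε' hj).2 (by ring)
      exact ⟨a2, ha2, h.eq_of_hasFoldedCoord hn (hgc a2 ha2) hj⟩
    · rintro ⟨b', hb', rfl⟩
      have hc := hgc b' hb'
      have hb'' : a ∈ neighbours b' := mem_neighbours.2 (mem_neighbours.1 hb').symm
      refine ⟨h.mem_posRoots_of_hasFoldedCoord hn hc,
        ⟨.head (b := x) ?_ (.single ?_), .head (b := y) ?_ (.single ?_)⟩, b', hc⟩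
      · exact (h.arrow_iff hn).2 ⟨b, a, p - 4, hα, by convert hx using 1; ring, hab⟩
      · exact (h.arrow_iff hn).2 ⟨a, b', p - 3, hx, by convert hc using 1; ring, hb'⟩
      · exact (h.arrow_iff hn).2 ⟨b', a, p - 2, hc, by convert hy using 1; ring, hb''⟩
      · exact (h.arrow_iff hn).2 ⟨a, b, p - 1, hy, by convert hβ using 1; ring, hba⟩
  rw [hJ, Finset.sum_image, sum_neighbours, hαk, hβk]
  · obtain ⟨e, s, C, he, hs, hr, -⟩ := h.exists_sliceRoot_eq hn
    have hsb := hs b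
    have hd : (n : ℤ) - b.val = 1 := by omega
    rw [dif_pos (by simp only [ha]; omega)]
    have hb1 : (⟨a.val + 1, by simp only [ha]; omega⟩ : Fin n) = b :=
      Fin.ext (by simp only [ha]; omega)
    rw [hb1]
    obtain hmb : m b = k + 1 := by
      have := hm b hba
      omega
    rw [hmb, hr, hr, hr, hd]
    -- For n = 2 the second neighbour of a is missing, and e_m + e_{m+3} = 0 by antiperiodicity.
    have hlow : (if _h : 0 < a.val then h.coxeter.sliceRoot hn ⟨a.val - 1, by omega⟩
        (m ⟨a.val - 1, by omega⟩) else 0) = e (s b + k) + e (s b + k + 3) := by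
      split_ifs with h0
      · have hn3 : (⟨a.val - 1, by omega⟩ : Fin n) ∈ neighbours a :=
          mem_neighbours.2 (Or.inr (by simp only; omega))
        have h1 := hm _ hn3
        have h2 := hs ⟨a.val - 1, by omega⟩
        have h3 : (n : ℤ) - ((⟨a.val - 1, by omega⟩ : Fin n).val : ℤ) = 3 := by
          simp only [ha] at h0 ⊢
          omega
        rw [hr]
        rw [h3] at h2 ⊢
        have h4 : s ⟨a.val - 1, by omega⟩ + (m ⟨a.val - 1, by omega⟩ : ℤ) = s b + k := by omega
        rw [h4]
      · have hn2 : (n : ℤ) + 1 = 3 := by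
          simp only [ha] at h0
          omega
        rw [← hn2, he, add_neg_cancel]
    rw [hlow]
    push_cast
    rw [show s b + ((k : ℤ) + 2) + 1 = s b + k + 3 by ring,
      show s b + ((k : ℤ) + 1) + 1 = s b + (k + 2) by ring,
      show s b + (k : ℤ) + 1 = s b + (k + 1) by ring]
    abel
  · intro x hx y hy hxy
    have hc := hgc x hx
    rw [show h.coxeter.sliceRoot hn x (m x) = h.coxeter.sliceRoot hn y (m y) from hxy] at hc
    exact (h.hasFoldedCoord_unique hn hc (hgc y hy)).1

end

end TwistedD

theorem theorem6p4 (n : ℕ) [NeZero n] (hn : 2 ≤ n) (w : List (Fin (n + 1)))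
    (hw : TwistedD.IsTwistedAdapted w) :
    (∃ c Q ξ, TwistedD.IsCoordinateDatum w c Q ξ) ∧
    ∀ (c : List (Fin (n + 1))) (Q : Fin n → Fin n → Prop) (ξ : Fin n → ℤ),
      TwistedD.IsCoordinateDatum w c Q ξ →
      ∀ α ∈ TwistedD.posRoots n, ∀ β ∈ TwistedD.posRoots n, ∀ (i : Fin n) (p : ℤ),
        TwistedD.HasFoldedCoord c ξ α i (p - 2 ^ TwistedD.orbitSize i) →
        TwistedD.HasFoldedCoord c ξ β i p →
        α + β = ∑ γ ∈ TwistedD.betweenAt c ξ α β (p - 2 ^ (TwistedD.orbitSize i - 1)), γ := by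
  refine ⟨hw.exists_coordinateDatum hn, fun c Q ξ h α _ β _ i p hα hβ => ?_⟩
  rw [TwistedD.orbitSize_eq hn] at hα ⊢
  split_ifs at hα ⊢ with hi
  · exact h.add_eq_sum_of_long hn hi hα hβ
  · exact h.add_eq_sum_of_short hn hi hα hβ
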